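/- Let $\mu$ be a finite Borel measure on $[0,\infty)$ with compact support, let $\gamma, r>0$, and let $R,\widetilde R\ge 0$ be not both zero. For $k\ge 0$ put $h_k(t)=\int_{[0,\infty)} x^k e^{-2\gamma t x}\,d\mu(x)$, and put $\theta=\frac{\gamma r}{2}\int_{[0,\infty)} x\,d\mu(x)$. Assume that $\gamma<\gamma_0:=\bigl(\frac r2\int_{[0,\infty)} x\,d\mu(x)\bigr)^{-1}$, so that $\theta<1$. Let $\lambda^-$ be the leftmost point of the support of the restriction of $\mu$ to $(0,\infty)$. Suppose that $\lambda^-=0$ and that $\mu$ is left-edge regular: there are $\alpha>0$ and a slowly varying function $L$ (that is, $L(tx)/L(t)\to1$ as $t\to\infty$ for every $x>0$) with $$\mu\bigl((\lambda^-,\lambda^-+t]\bigr)\sim t^{\alpha}L(1/t)\qquad\text{as } t\downarrow 0 .$$ Then the Volterra equation $$\psi_0(t)=\tfrac R2h_1(t)+\tfrac{\widetilde R}{2}\bigl(rh_0(t)+(1-r)\bigr)+\gamma^2 r\int_0^t h_2(t-s)\psi_0(s)\,ds\qquad(t\ge0)$$ has a unique locally integrable solution $\psi_0$ on $[0,\infty)$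 (the equation being required at every $t\ge 0$), the limit $$\psi_0(\infty):=\lim_{t\to\infty}\psi_0(t)=\frac{\widetilde R}{2}\cdot\frac{r\mu(\{0\})+1-r}{1-\theta}$$ exists, and as $t\to\infty$ $$\psi_0(t)-\psi_0(\infty)\sim\frac{1}{1-\theta}\begin{cases}(2\gamma)^{-\alpha}\,\dfrac{\widetilde R r}{2}\,t^{-\alpha}L(t)\,\Gamma(1+\alpha)&\text{if }\widetilde R>0,\\[2mm](2\gamma)^{-1-\alpha}\,\dfrac{\alpha}{1+\alpha}\,\dfrac{R}{2}\,t^{-1-\alpha}L(t)\,\Gamma(2+\alpha)&\text{if }\widetilde R=0.\end{cases}$$ Here $f\sim g$ means that $f/g\to1$. -/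

import Mathlib

open MeasureTheory Set Filter Topology Asymptotics

namespace SGDVolterra

/-- The moment functions `h_k(t) = ∫_{[0,∞)} x^k e^{-2γtx} dμ(x)` (the atom at `0` is included). -/
noncomputable def h (μ : Measure ℝ) (γ : ℝ) (k : ℕ) (t : ℝ) : ℝ :=
  ∫ x in Ici (0 : ℝ), x ^ k * Real.exp (-2 * γ * t * x) ∂μ

/-- The first moment `∫_{[0,∞)} x dμ(x)`. -/
noncomputable def firstMoment (μ : Measure ℝ) : ℝ :=
  ∫ x in Ici (0 : ℝ), x ∂μ

/-- The forcing function `z(t) = (R/2) h_1(t) + (R'/2) (r h_0(t) + (1 - r))`. -/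
noncomputable def forcing (μ : Measure ℝ) (γ r R R' : ℝ) (t : ℝ) : ℝ :=
  R / 2 * h μ γ 1 t + R' / 2 * (r * h μ γ 0 t + (1 - r))

/-- `ψ` solves the Volterra equation
`ψ(t) = z(t) + γ² r ∫_0^t h_2(t-s) ψ(s) ds` for every `t ≥ 0`, in the usual class of locally
integrable functions on `[0,∞)`. -/
structure IsVolterraSolution (μ : Measure ℝ) (γ r R R' : ℝ) (ψ : ℝ → ℝ) : Prop where
  locallyIntegrable : LocallyIntegrableOn ψ (Ici 0) volume
  equation : ∀ t : ℝ, 0 ≤ t →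
    ψ t = forcing μ γ r R R' t + γ ^ 2 * r * ∫ s in (0 : ℝ)..t, h μ γ 2 (t - s) * ψ s

/-- `γ₀ = ((r/2) ∫ x dμ(x))⁻¹`, below which the solution is bounded. -/
noncomputable def gammaZero (μ : Measure ℝ) (r : ℝ) : ℝ :=
  (r / 2 * firstMoment μ)⁻¹

/-- `θ = (γ r / 2) ∫ x dμ(x)`. -/
noncomputable def theta (μ : Measure ℝ) (γ r : ℝ) : ℝ :=
  γ * r / 2 * firstMoment μ

/-- The limiting value `ψ₀(∞) = (R'/2) (r μ({0}) + (1 - r)) / (1 - θ)`. -/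
noncomputable def psiInfty (μ : Measure ℝ) (γ r R' : ℝ) : ℝ :=
  R' / 2 * ((r * μ.real {0} + (1 - r)) / (1 - theta μ γ r))

/-- `λ⁻`: the leftmost point of the support of `μ` restricted to `(0,∞)`. -/
noncomputable def leftEdge (μ : Measure ℝ) : ℝ :=
  sInf (μ.restrict (Ioi 0)).support

/-- `L` is slowly varying at infinity; only its values at large positive arguments matter. -/
def SlowlyVarying (L : ℝ → ℝ) : Prop :=
  ∀ x : ℝ, 0 < x → Tendsto (fun t : ℝ => L (t * x) / L t) atTop (𝓝 1)

/-- Left-edge regularity with exponent `α` and slowly varying function `L`: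
`μ((λ⁻, λ⁻ + t]) ∼ t^α L(1/t)` as `t ↓ 0`. -/
def LeftEdgeRegular (μ : Measure ℝ) (α : ℝ) (L : ℝ → ℝ) : Prop :=
  SlowlyVarying L ∧
    (fun t : ℝ => μ.real (Ioc (leftEdge μ) (leftEdge μ + t)))
      ~[𝓝[>] 0] (fun t : ℝ => t ^ α * L (1 / t))

end SGDVolterra

/-! Let `ν` be `μ` restricted to `(0,∞)` and `H_k(s) = ∫ x^k e^{-sx} dν`. The atom at `0` only adds
a constant to `h_0`, so the kernel is `K(t) = γ² r H_2(2γt)`. Since `H_1' = -H_2`, its total mass is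
`γ² r H_1(0)/(2γ) = θ < 1`. Existence is therefore a contraction argument in the sup norm, and
uniqueness follows by iterating the homogeneous inequality.

Subtracting `P = ψ₀(∞)` removes every constant from the forcing: `u = ψ₀ - P` satisfies `u = w + K *
u`, where `w` is a combination of `H_1(2γt)` and `H_0(2γt)` alone. An Abelian theorem
(`tendsto_laplaceMoment_mul_pow_div`) gives `H_k(s) ∼ α Γ(α+k) s^{-k} ν((0,1/s])`. Hence `H_1 =
o(H_0)`, and `w` is led by `(R' r/2) H_0` if `R' > 0`, while `w = (R/2) H_1` if `R' = 0`.

The factor `1/(1-θ)` comes from a subexponential principle. For `g = H_k(2γ·)` with `k ≤ 1`,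
polynomial decay gives `(K * g)/g → θ` (`tendsto_convolution_div`): the mass of `K` sits at bounded
times, where `g(t-s) ≈ g(t)`, and the opposite end of the convolution is negligible because `K =
O(g/t)`. If `w ∼ c g`, then `c g/(1-θ)` solves the equation up to `o(g)`, and an error forced by
`o(g)` is itself `o(g)` because `θ < 1` (`volterra_isLittleO`). -/

namespace SGDVolterra

/-- The Laplace transform `∫ x^k e^{-sx} dν(x)` of the `k`-th moment measure of `ν`. -/
noncomputable def laplaceMoment (ν : Measure ℝ) (k : ℕ) (s : ℝ) : ℝ :=
  ∫ x, x ^ k * Real.exp (-s * x) ∂ν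

/-! ### Laplace transforms of moment measures: regularity, monotonicity, elementary inequalities. -/

section LaplaceMoment

variable {ν : Measure ℝ} {M : ℝ}

theorem laplaceMoment_nonneg (hν : ∀ᵐ x ∂ν, x ∈ Ioc 0 M) (k : ℕ) (s : ℝ) :
    0 ≤ laplaceMoment ν k s := by
  refine integral_nonneg_of_ae ?_
  filter_upwards [hν] with x hx
  exact mul_nonneg (pow_nonneg hx.1.le _) (Real.exp_pos _).le

variable [IsFiniteMeasure ν]

theorem integrable_pow_mul_exp (hν : ∀ᵐ x ∂ν, x ∈ Ioc 0 M) (k : ℕ) (s : ℝ) :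
    Integrable (fun x => x ^ k * Real.exp (-s * x)) ν := by
  refine Integrable.of_bound (by fun_prop) (M ^ k * Real.exp (|s| * M)) ?_
  filter_upwards [hν] with x hx
  rw [Real.norm_eq_abs, abs_of_nonneg (mul_nonneg (pow_nonneg hx.1.le _) (Real.exp_pos _).le)]
  have h1 : -s * x ≤ |s| * M :=
    (mul_le_mul_of_nonneg_right (neg_le_abs s) hx.1.le).trans
      (mul_le_mul_of_nonneg_left hx.2 (abs_nonneg s))
  have h2 := hx.1.le
  have h3 := hx.2
  have h4 := h2.trans h3
  gcongr

theorem hasDerivAt_laplaceMoment (hν : ∀ᵐ x ∂ν, x ∈ Ioc 0 M) (k : ℕ) (s : ℝ) :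
    HasDerivAt (laplaceMoment ν k) (-laplaceMoment ν (k + 1) s) s := by
  have key := hasDerivAt_integral_of_dominated_loc_of_deriv_le (μ := ν)
    (F := fun s x => x ^ k * Real.exp (-s * x))
    (F' := fun s x => -(x ^ (k + 1) * Real.exp (-s * x))) (x₀ := s)
    -- On the unit ball `y ≥ s - 1`, and `x > 0` almost everywhere, so the integrand at parameter `s
    -- - 1` dominates.
    (s := Metric.ball s 1) (bound := fun x => x ^ (k + 1) * Real.exp (-(s - 1) * x))
    (Metric.ball_mem_nhds s one_pos)
    (Eventually.of_forall fun _ => by fun_prop)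
    (integrable_pow_mul_exp hν k s) (by fun_prop) ?_
    (integrable_pow_mul_exp hν (k + 1) (s - 1)) ?_
  · have := key.2
    rwa [integral_neg] at this
  · filter_upwards [hν] with x hx y hy
    rw [Metric.mem_ball, Real.dist_eq, abs_lt] at hy
    rw [norm_neg, Real.norm_eq_abs,
      abs_of_nonneg (mul_nonneg (pow_nonneg hx.1.le _) (Real.exp_pos _).le)]
    have h2 := hx.1.le
    have : s - 1 ≤ y := by linarith [hy.1]
    gcongr
  · refine Eventually.of_forall fun x y _ => ?_
    have h1 : HasDerivAt (fun y : ℝ => -y * x) (-1 * x) y := (hasDerivAt_id y).neg.mul_const x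
    have h2 := (h1.exp).const_mul (x ^ k)
    have h3 : x ^ k * (Real.exp (-y * x) * (-1 * x)) =
        -(x ^ (k + 1) * Real.exp (-y * x)) := by ring
    rwa [h3] at h2

theorem continuous_laplaceMoment (hν : ∀ᵐ x ∂ν, x ∈ Ioc 0 M) (k : ℕ) :
    Continuous (laplaceMoment ν k) :=
  continuous_iff_continuousAt.2 fun s => (hasDerivAt_laplaceMoment hν k s).continuousAt

theorem laplaceMoment_pos (hν : ∀ᵐ x ∂ν, x ∈ Ioc 0 M) (h0 : ν ≠ 0) (k : ℕ) (s : ℝ) :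
    0 < laplaceMoment ν k s := by
  have hpos : ∀ᵐ x ∂ν, 0 < x ^ k * Real.exp (-s * x) := by
    filter_upwards [hν] with x hx
    exact mul_pos (pow_pos hx.1 _) (Real.exp_pos _)
  refine (integral_pos_iff_support_of_nonneg_ae (hpos.mono fun x hx => hx.le)
    (integrable_pow_mul_exp hν k s)).2 ?_
  rw [pos_iff_ne_zero]
  intro h
  apply h0
  rw [← Measure.measure_univ_eq_zero]
  refine measure_mono_null (t := Function.support (fun x => x ^ k * Real.exp (-s * x)) ∪
    (Function.support (fun x => x ^ k * Real.exp (-s * x)))ᶜ) (by simp) ?_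
  refine measure_union_null h ?_
  have : ∀ᵐ x ∂ν, x ∈ Function.support (fun x => x ^ k * Real.exp (-s * x)) :=
    hpos.mono fun x hx => hx.ne'
  exact this

theorem antitone_laplaceMoment (hν : ∀ᵐ x ∂ν, x ∈ Ioc 0 M) (k : ℕ) :
    Antitone (laplaceMoment ν k) := by
  intro a b hab
  refine integral_mono_ae (integrable_pow_mul_exp hν k b) (integrable_pow_mul_exp hν k a) ?_
  filter_upwards [hν] with x hx
  have h2 := hx.1.le
  gcongr

theorem tendsto_laplaceMoment_atTop (hν : ∀ᵐ x ∂ν, x ∈ Ioc 0 M) (k : ℕ) :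
    Tendsto (laplaceMoment ν k) atTop (𝓝 0) := by
  have key := tendsto_integral_filter_of_dominated_convergence (μ := ν) (l := atTop)
    (F := fun s x => x ^ k * Real.exp (-s * x)) (f := fun _ => (0 : ℝ))
    (fun x => x ^ k * Real.exp (-0 * x)) (Eventually.of_forall fun _ => by fun_prop) ?_
    (integrable_pow_mul_exp hν k 0) ?_
  · rwa [integral_zero] at key
  · filter_upwards [eventually_ge_atTop 0] with s hs
    filter_upwards [hν] with x hx
    rw [Real.norm_eq_abs, abs_of_nonneg (mul_nonneg (pow_nonneg hx.1.le _) (Real.exp_pos _).le)]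
    have h2 := hx.1.le
    gcongr
  · filter_upwards [hν] with x hx
    have h1 : Tendsto (fun s : ℝ => -s * x) atTop atBot := by
      have h2 : Tendsto (fun s : ℝ => s * x) atTop atTop := tendsto_id.atTop_mul_const hx.1
      simpa only [neg_mul, Function.comp_def] using tendsto_neg_atTop_atBot.comp h2
    simpa using (Real.tendsto_exp_atBot.comp h1).const_mul (x ^ k)

theorem integral_laplaceMoment (hν : ∀ᵐ x ∂ν, x ∈ Ioc 0 M) (k : ℕ) (a b : ℝ) :
    ∫ s in a..b, laplaceMoment ν (k + 1) s = laplaceMoment ν k a - laplaceMoment ν k b := by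
  have := intervalIntegral.integral_eq_sub_of_hasDerivAt
    (f := fun s => -laplaceMoment ν k s) (f' := laplaceMoment ν (k + 1)) (a := a) (b := b)
    (fun s _ => by
      have h := (hasDerivAt_laplaceMoment hν k s).neg
      rwa [neg_neg] at h)
    ((continuous_laplaceMoment hν (k + 1)).intervalIntegrable _ _)
  rw [this]; ring

/-- Half of the exponential absorbs the extra factor: `(sx/2) e^{-sx/2} ≤ 1`. With a doubling bound
this yields `H_{k+1}(s) = O(H_k(s)/s)`. -/
theorem mul_laplaceMoment_succ_le (hν : ∀ᵐ x ∂ν, x ∈ Ioc 0 M) (k : ℕ) (s : ℝ) :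
    s * laplaceMoment ν (k + 1) s ≤ 2 * laplaceMoment ν k (s / 2) := by
  unfold laplaceMoment
  rw [← integral_const_mul, ← integral_const_mul]
  refine integral_mono_ae ((integrable_pow_mul_exp hν _ _).const_mul _)
    ((integrable_pow_mul_exp hν _ _).const_mul _) ?_
  filter_upwards [hν] with x hx
  have e : Real.exp (-s * x) = Real.exp (-(s / 2) * x) * Real.exp (-(s / 2) * x) := by
    rw [← Real.exp_add]; ring_nf
  have h1 : (s / 2 * x) * Real.exp (-(s / 2) * x) ≤ 1 := by
    have h2 := Real.add_one_le_exp (s / 2 * x)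
    have h3 : Real.exp (s / 2 * x) * Real.exp (-(s / 2) * x) = 1 := by
      rw [← Real.exp_add]; simp
    nlinarith [Real.exp_pos (-(s / 2) * x)]
  have h4 : 0 ≤ x ^ k * Real.exp (-(s / 2) * x) :=
    mul_nonneg (pow_nonneg hx.1.le _) (Real.exp_pos _).le
  calc s * (x ^ (k + 1) * Real.exp (-s * x))
      = 2 * (x ^ k * Real.exp (-(s / 2) * x)) * ((s / 2 * x) * Real.exp (-(s / 2) * x)) := by
        rw [e]; ring
    _ ≤ 2 * (x ^ k * Real.exp (-(s / 2) * x)) * 1 := by gcongr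
    _ = _ := by ring

/-- Integrates `e^{-ax} ≥ 1 - ax` against `x^k e^{-(s-a)x}`. It controls the effect of a bounded
shift of the argument. -/
theorem laplaceMoment_sub_le (hν : ∀ᵐ x ∂ν, x ∈ Ioc 0 M) (k : ℕ) (s a : ℝ) :
    laplaceMoment ν k (s - a) ≤ laplaceMoment ν k s + a * laplaceMoment ν (k + 1) (s - a) := by
  unfold laplaceMoment
  rw [← integral_const_mul, ← integral_add (integrable_pow_mul_exp hν _ _)
    ((integrable_pow_mul_exp hν _ _).const_mul _)]
  refine integral_mono_ae (integrable_pow_mul_exp hν _ _)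
    ((integrable_pow_mul_exp hν _ _).add ((integrable_pow_mul_exp hν _ _).const_mul _)) ?_
  filter_upwards [hν] with x hx
  have e : Real.exp (-s * x) = Real.exp (-(s - a) * x) * Real.exp (-(a * x)) := by
    rw [← Real.exp_add]; ring_nf
  have h2 := Real.add_one_le_exp (-(a * x))
  have h4 : 0 ≤ x ^ k * Real.exp (-(s - a) * x) :=
    mul_nonneg (pow_nonneg hx.1.le _) (Real.exp_pos _).le
  rw [e]
  have h5 := mul_le_mul_of_nonneg_left h2 h4
  have h6 : x ^ k * Real.exp (-(s - a) * x) * (-(a * x) + 1) + a * (x ^ (k + 1) *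
      Real.exp (-(s - a) * x)) = x ^ k * Real.exp (-(s - a) * x) := by ring
  linarith

end LaplaceMoment


/-! ### The Abelian theorem: behaviour of `ν` near `0` governs `H_k` at infinity. -/

section Abelian

theorem integrableOn_one_add_pow_mul_exp_neg (N : ℕ) :
    IntegrableOn (fun v : ℝ => (1 + v) ^ N * Real.exp (-v)) (Ioi 0) := by
  refine integrable_of_isBigO_exp_neg (b := 1 / 2) (by norm_num) (by fun_prop) ?_
  have h1 : (fun v : ℝ => (1 + v) ^ N) =O[atTop] fun v => Real.exp (1 / 2 * (1 + v)) :=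
    ((isLittleO_pow_exp_pos_mul_atTop N (b := 1 / 2) (by norm_num)).comp_tendsto
      (tendsto_atTop_add_const_left atTop (1 : ℝ) tendsto_id)).isBigO
  have h2 : (fun v : ℝ => Real.exp (1 / 2 * (1 + v)) * Real.exp (-v)) =
      fun v => Real.exp (1 / 2) * Real.exp (-(1 / 2) * v) := by
    funext v
    rw [← Real.exp_add, ← Real.exp_add]
    ring_nf
  refine (h1.mul (isBigO_refl (fun v : ℝ => Real.exp (-v)) atTop)).trans ?_
  rw [h2]
  exact isBigO_const_mul_self _ _ _

/-- Minus the derivative of `v ↦ v^k e^{-v}`. -/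
noncomputable def negDerivPowExp (k : ℕ) (v : ℝ) : ℝ :=
  (v ^ k - k * v ^ (k - 1)) * Real.exp (-v)

theorem continuous_negDerivPowExp (k : ℕ) : Continuous (negDerivPowExp k) := by
  unfold negDerivPowExp; fun_prop

theorem abs_negDerivPowExp_le (k : ℕ) {v : ℝ} (hv : 0 ≤ v) :
    |negDerivPowExp k v| ≤ (1 + k) * ((1 + v) ^ k * Real.exp (-v)) := by
  unfold negDerivPowExp
  rw [abs_mul, abs_of_pos (Real.exp_pos _), ← mul_assoc]
  refine mul_le_mul_of_nonneg_right ?_ (Real.exp_pos _).le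
  have h1 : v ^ k ≤ (1 + v) ^ k := by gcongr; linarith
  have h2 : v ^ (k - 1) ≤ (1 + v) ^ k :=
    (pow_le_pow_left₀ hv (by linarith) _).trans
      (pow_le_pow_right₀ (by linarith) (Nat.sub_le k 1))
  have h3 : 0 ≤ v ^ k := by positivity
  have h4 : 0 ≤ (k : ℝ) * v ^ (k - 1) := by positivity
  have h5 : (k : ℝ) * v ^ (k - 1) ≤ k * (1 + v) ^ k := by gcongr
  rw [abs_le]
  constructor <;> nlinarith

theorem integrableOn_negDerivPowExp (k : ℕ) : IntegrableOn (negDerivPowExp k) (Ioi 0) := by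
  refine Integrable.mono' ((integrableOn_one_add_pow_mul_exp_neg k).const_mul (1 + (k : ℝ)))
    (continuous_negDerivPowExp k).aestronglyMeasurable ?_
  filter_upwards [ae_restrict_mem measurableSet_Ioi] with v hv
  exact abs_negDerivPowExp_le k (le_of_lt hv)

theorem integral_Ioi_negDerivPowExp (k : ℕ) {y : ℝ} (hy : 0 ≤ y) :
    ∫ v in Ioi y, negDerivPowExp k v = y ^ k * Real.exp (-y) := by
  have h := integral_Ioi_of_hasDerivAt_of_tendsto' (a := y) (m := 0)
    (f := fun v : ℝ => -(v ^ k * Real.exp (-v))) (f' := negDerivPowExp k) (fun v _ => ?_)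
    ((integrableOn_negDerivPowExp k).mono_set (Ioi_subset_Ioi hy)) ?_
  · rw [h]; ring
  · have h1 := ((hasDerivAt_pow k v).mul (hasDerivAt_neg v).exp).neg
    have h2 : -(k * v ^ (k - 1) * Real.exp (-v) + v ^ k * (Real.exp (-v) * -1)) =
        negDerivPowExp k v := by unfold negDerivPowExp; ring
    rw [h2] at h1
    exact h1
  · simpa using (Real.tendsto_pow_mul_exp_neg_atTop_nhds_zero k).neg

/-- The two terms are Gamma integrals, and `Γ(α+k+1) - k Γ(α+k) = α Γ(α+k)`. -/
theorem integral_negDerivPowExp_mul_rpow {α : ℝ} (hα : 0 < α) (k : ℕ) :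
    ∫ v in Ioi (0 : ℝ), negDerivPowExp k v * v ^ α = α * Real.Gamma (α + k) := by
  have hk : (0 : ℝ) < α + k := by positivity
  have i1 := Real.GammaIntegral_convergent (s := α + k + 1) (by linarith)
  have i2 := Real.GammaIntegral_convergent hk
  have e : ∫ v in Ioi (0 : ℝ), negDerivPowExp k v * v ^ α =
      ∫ v in Ioi (0 : ℝ), (Real.exp (-v) * v ^ (α + k + 1 - 1) -
        k * (Real.exp (-v) * v ^ (α + k - 1))) := by
    refine setIntegral_congr_fun measurableSet_Ioi fun v hv => ?_
    have hv0 : (0 : ℝ) < v := hv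
    have p1 : v ^ (α + k + 1 - 1) = v ^ k * v ^ α := by
      rw [add_sub_cancel_right, Real.rpow_add hv0, Real.rpow_natCast, mul_comm]
    have p2 : (k : ℝ) * v ^ (k - 1) * v ^ α = k * v ^ (α + k - 1) := by
      -- For `k = 0` the truncated exponent `k - 1` is harmless, since the coefficient `k` vanishes.
      rcases Nat.eq_zero_or_pos k with rfl | hk1
      · simp
      · rw [add_sub_assoc, Real.rpow_add hv0, ← Real.rpow_natCast, Nat.cast_sub hk1, Nat.cast_one]
        ring
    simp only [negDerivPowExp, p1]
    linear_combination (-Real.exp (-v)) * p2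
  rw [e, integral_sub i1 (i2.const_mul _), integral_const_mul, ← Real.Gamma_eq_integral hk,
    ← Real.Gamma_eq_integral (by linarith), Real.Gamma_add_one hk.ne']
  ring

variable {ν : Measure ℝ} [IsFiniteMeasure ν] {M α : ℝ}

/-- Integration by parts in the form of Fubini: `(sx)^k e^{-sx}` is the integral of `negDerivPowExp
k` over `v ≥ sx`, and exchanging the integrals turns `sx ≤ v` into `x ≤ v/s`. -/
theorem laplaceMoment_mul_pow_eq (hν : ∀ᵐ x ∂ν, x ∈ Ioc 0 M) (k : ℕ) {s : ℝ} (hs : 0 < s) :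
    laplaceMoment ν k s * s ^ k =
      ∫ v in Ioi (0 : ℝ), negDerivPowExp k v * ν.real (Iic (v / s)) := by
  set S : Set (ℝ × ℝ) := {q | s * q.1 ≤ q.2} with hSdef
  have hS : MeasurableSet S := measurableSet_le (by fun_prop) (by fun_prop)
  have hint : Integrable (S.indicator fun q : ℝ × ℝ => negDerivPowExp k q.2)
      (ν.prod (volume.restrict (Ioi 0))) :=
    (Integrable.comp_snd (integrableOn_negDerivPowExp k) ν).indicator hS
  have hswap := integral_integral_swap
    (f := fun x v => S.indicator (fun q : ℝ × ℝ => negDerivPowExp k q.2) (x, v)) hint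
  have hleft : ∫ x, (∫ v in Ioi (0 : ℝ),
      S.indicator (fun q : ℝ × ℝ => negDerivPowExp k q.2) (x, v)) ∂ν =
      laplaceMoment ν k s * s ^ k := by
    unfold laplaceMoment
    rw [← integral_mul_const]
    refine integral_congr_ae ?_
    filter_upwards [hν] with x hx
    have hsx : 0 < s * x := mul_pos hs hx.1
    have e1 : (fun v => S.indicator (fun q : ℝ × ℝ => negDerivPowExp k q.2) (x, v)) =
        (Ici (s * x)).indicator (negDerivPowExp k) := by
      funext v
      by_cases h : s * x ≤ v
      · rw [indicator_of_mem (show (x, v) ∈ S from h),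
          indicator_of_mem (show v ∈ Ici (s * x) from h)]
      · rw [indicator_of_notMem (show (x, v) ∉ S from h),
          indicator_of_notMem (show v ∉ Ici (s * x) from h)]
    rw [e1, setIntegral_indicator measurableSet_Ici,
      inter_eq_self_of_subset_right (Ici_subset_Ioi.2 hsx),
      integral_Ici_eq_integral_Ioi, integral_Ioi_negDerivPowExp k hsx.le, mul_pow, neg_mul]
    ring
  rw [← hleft, hswap]
  refine setIntegral_congr_fun measurableSet_Ioi fun v _ => ?_
  have e1 : (fun x => S.indicator (fun q : ℝ × ℝ => negDerivPowExp k q.2) (x, v)) =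
      (Iic (v / s)).indicator (fun _ => negDerivPowExp k v) := by
    funext x
    have hiff : x ≤ v / s ↔ s * x ≤ v := by rw [le_div_iff₀ hs, mul_comm]
    by_cases h : s * x ≤ v
    · rw [indicator_of_mem (show (x, v) ∈ S from h),
        indicator_of_mem (show x ∈ Iic (v / s) from hiff.2 h)]
    · rw [indicator_of_notMem (show (x, v) ∉ S from h),
        indicator_of_notMem (show x ∉ Iic (v / s) from fun h' => h (hiff.1 h'))]
  simp only [e1]
  rw [integral_indicator measurableSet_Iic, setIntegral_const, smul_eq_mul, mul_comm]

/-- A crude Potter bound, uniform in `y`, which supplies domination in the Abelian theorem. It comes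
from iterating a doubling inequality along powers of `2`. -/
theorem exists_measureReal_Iic_mul_le (hpos : ∀ y, 0 < y → 0 < ν.real (Iic y))
    (hrv : ∀ v, 0 < v →
      Tendsto (fun s => ν.real (Iic (v / s)) / ν.real (Iic (1 / s))) atTop (𝓝 (v ^ α))) :
    ∃ m : ℕ, ∀ y, 0 < y → ∀ v, 0 < v →
      ν.real (Iic (v * y)) ≤ (2 * (1 + v)) ^ m * ν.real (Iic y) := by
  have hmono : Monotone fun y => ν.real (Iic y) := fun a b hab =>
    measureReal_mono (Iic_subset_Iic.2 hab)
  obtain ⟨S, hS⟩ := eventually_atTop.1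
    (((tendsto_order.1 (hrv 2 two_pos)).2 (2 ^ α + 1) (by linarith)).and
      (eventually_gt_atTop (0 : ℝ)))
  have hS0 : 0 < S := (hS S le_rfl).2
  have hFS := hpos (1 / S) (by positivity)
  -- The regular variation limit gives doubling only for `y ≤ 1/S`; for larger `y` the finite total
  -- mass is compared with the mass up to `1/S`.
  set C := max (2 ^ α + 1) (ν.real univ / ν.real (Iic (1 / S)))
  have hdouble : ∀ y, 0 < y → ν.real (Iic (2 * y)) ≤ C * ν.real (Iic y) := by
    intro y hy
    rcases le_total y (1 / S) with h | h
    · have h1 := (hS (1 / y) (by rw [le_div_iff₀ hy]; rw [le_div_iff₀ hS0] at h; linarith)).1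
      rw [one_div_one_div, div_div_eq_mul_div, div_one, div_lt_iff₀ (hpos y hy)] at h1
      exact h1.le.trans (mul_le_mul_of_nonneg_right (le_max_left _ _) (hpos y hy).le)
    · calc ν.real (Iic (2 * y)) ≤ ν.real univ := measureReal_mono (subset_univ _)
        _ = ν.real univ / ν.real (Iic (1 / S)) * ν.real (Iic (1 / S)) :=
          (div_mul_cancel₀ _ hFS.ne').symm
        _ ≤ C * ν.real (Iic y) :=
          mul_le_mul (le_max_right _ _) (hmono h) hFS.le
            (le_max_of_le_left (by positivity))
  obtain ⟨m, hm⟩ := pow_unbounded_of_one_lt C (one_lt_two (α := ℝ))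
  refine ⟨m, fun y hy v hv => ?_⟩
  have hpow : ∀ n : ℕ, ν.real (Iic (2 ^ n * y)) ≤ (2 ^ n) ^ m * ν.real (Iic y) := by
    intro n
    induction n with
    | zero => simp
    | succ n ih =>
      have hy' : 0 < 2 ^ n * y := by positivity
      calc ν.real (Iic (2 ^ (n + 1) * y)) = ν.real (Iic (2 * (2 ^ n * y))) := by ring_nf
        _ ≤ C * ν.real (Iic (2 ^ n * y)) := hdouble _ hy'
        _ ≤ 2 ^ m * ((2 ^ n) ^ m * ν.real (Iic y)) :=
          mul_le_mul hm.le ih (hpos _ hy').le (by positivity)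
        _ = (2 ^ (n + 1)) ^ m * ν.real (Iic y) := by rw [pow_succ, mul_pow]; ring
  -- Here `2^n ≤ 1 + v < 2^(n+1)`, which is the source of the base `2 (1 + v)`.
  obtain ⟨n, hn1, hn2⟩ := exists_nat_pow_near (show (1 : ℝ) ≤ 1 + v by linarith)
    (one_lt_two (α := ℝ))
  calc ν.real (Iic (v * y)) ≤ ν.real (Iic (2 ^ (n + 1) * y)) :=
        hmono (mul_le_mul_of_nonneg_right (by linarith) hy.le)
    _ ≤ (2 ^ (n + 1)) ^ m * ν.real (Iic y) := hpow _
    _ ≤ (2 * (1 + v)) ^ m * ν.real (Iic y) := by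
        have : (2 : ℝ) ^ (n + 1) ≤ 2 * (1 + v) := by rw [pow_succ]; linarith
        gcongr

/-- The Abelian half of Karamata's theorem for the moment measures of `ν`. -/
theorem tendsto_laplaceMoment_mul_pow_div (hν : ∀ᵐ x ∂ν, x ∈ Ioc 0 M) (hα : 0 < α)
    (hpos : ∀ y, 0 < y → 0 < ν.real (Iic y))
    (hrv : ∀ v, 0 < v →
      Tendsto (fun s => ν.real (Iic (v / s)) / ν.real (Iic (1 / s))) atTop (𝓝 (v ^ α)))
    (k : ℕ) :
    Tendsto (fun s => laplaceMoment ν k s * s ^ k / ν.real (Iic (1 / s))) atTop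
      (𝓝 (α * Real.Gamma (α + k))) := by
  obtain ⟨m, hm⟩ := exists_measureReal_Iic_mul_le hpos hrv
  have hmono : Monotone fun y => ν.real (Iic y) := fun a b hab =>
    measureReal_mono (Iic_subset_Iic.2 hab)
  rw [← integral_negDerivPowExp_mul_rpow hα k]
  have key : Tendsto (fun s => ∫ v in Ioi (0 : ℝ),
      negDerivPowExp k v * (ν.real (Iic (v / s)) / ν.real (Iic (1 / s)))) atTop
      (𝓝 (∫ v in Ioi (0 : ℝ), negDerivPowExp k v * v ^ α)) := by
    refine tendsto_integral_filter_of_dominated_convergence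
      (fun v => (1 + k) * 2 ^ m * ((1 + v) ^ (k + m) * Real.exp (-v))) ?_ ?_
      ((integrableOn_one_add_pow_mul_exp_neg (k + m)).const_mul _) ?_
    · filter_upwards [eventually_gt_atTop 0] with s hs
      have h1 : Monotone fun v => ν.real (Iic (v / s)) := fun a b hab =>
        hmono (div_le_div_of_nonneg_right hab hs.le)
      exact ((continuous_negDerivPowExp k).measurable.mul
        (h1.measurable.div_const _)).aestronglyMeasurable
    · filter_upwards [eventually_gt_atTop 0] with s hs
      filter_upwards [ae_restrict_mem measurableSet_Ioi] with v hv
      have hv0 : (0 : ℝ) < v := hv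
      have hs1 : 0 < 1 / s := by positivity
      have h1 : ν.real (Iic (v / s)) / ν.real (Iic (1 / s)) ≤ (2 * (1 + v)) ^ m := by
        rw [div_le_iff₀ (hpos _ hs1)]
        have := hm (1 / s) hs1 v hv0
        rwa [mul_one_div] at this
      rw [norm_mul, Real.norm_eq_abs, Real.norm_of_nonneg (by positivity)]
      calc _ ≤ (1 + k) * ((1 + v) ^ k * Real.exp (-v)) * (2 * (1 + v)) ^ m :=
            mul_le_mul (abs_negDerivPowExp_le k hv0.le) h1 (by positivity) (by positivity)
        _ = _ := by rw [mul_pow, pow_add]; ring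
    · filter_upwards [ae_restrict_mem measurableSet_Ioi] with v hv
      exact (hrv v hv).const_mul _
  refine key.congr' ?_
  filter_upwards [eventually_gt_atTop 0] with s hs
  rw [laplaceMoment_mul_pow_eq hν k hs, ← integral_div]
  simp only [mul_div_assoc]

/-- The Abelian theorem at `s` and at `s/2` shows that the ratio tends to `2^k * 2^α`; any larger
constant serves. -/
theorem exists_laplaceMoment_half_le (hν : ∀ᵐ x ∂ν, x ∈ Ioc 0 M) (hα : 0 < α)
    (hpos : ∀ y, 0 < y → 0 < ν.real (Iic y))
    (hrv : ∀ v, 0 < v →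
      Tendsto (fun s => ν.real (Iic (v / s)) / ν.real (Iic (1 / s))) atTop (𝓝 (v ^ α)))
    (k : ℕ) :
    ∃ C, 0 < C ∧ ∀ᶠ s in atTop, laplaceMoment ν k (s / 2) ≤ C * laplaceMoment ν k s := by
  have hν0 : ν ≠ 0 := by
    rintro rfl
    simpa using hpos 1 one_pos
  have hQ := tendsto_laplaceMoment_mul_pow_div hν hα hpos hrv k
  have hc : α * Real.Gamma (α + k) ≠ 0 :=
    (mul_pos hα (Real.Gamma_pos_of_pos (by positivity))).ne'
  have hQ2 := hQ.comp (tendsto_id.atTop_div_const (two_pos (α := ℝ)))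
  have hlim := (((hQ2.div hQ hc).mul (hrv 2 two_pos)).const_mul ((2 : ℝ) ^ k))
  rw [div_self hc, one_mul] at hlim
  refine ⟨2 ^ k * 2 ^ α + 1, by positivity, ?_⟩
  filter_upwards [(tendsto_order.1 hlim).2 _ (lt_add_one _), eventually_gt_atTop 0] with s hs hs0
  rw [← div_le_iff₀ (laplaceMoment_pos hν hν0 k s)]
  refine le_trans (le_of_eq ?_) hs.le
  have h1 := (laplaceMoment_pos hν hν0 k s).ne'
  have h2 := (hpos (1 / s) (by positivity)).ne'
  have h3 := (hpos (2 / s) (by positivity)).ne'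
  simp only [Pi.div_apply, Function.comp_apply, id_eq, one_div_div]
  rw [div_pow]
  field_simp

end Abelian


/-! ### Existence and uniqueness for Volterra equations with kernel mass below one. -/

section Existence

variable {K z : ℝ → ℝ} {θ : ℝ}

theorem integral_convolution_comm (K f : ℝ → ℝ) (t : ℝ) :
    ∫ s in (0 : ℝ)..t, K (t - s) * f s = ∫ s in (0 : ℝ)..t, K s * f (t - s) := by
  have := intervalIntegral.integral_comp_sub_left (a := 0) (b := t)
    (fun s => K s * f (t - s)) t
  simpa using this

theorem abs_convolution_le (hK : Continuous K) (hK0 : ∀ t, 0 ≤ K t)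
    {f b : ℝ → ℝ} (hf : Continuous f) (hb : Continuous b) {a t c : ℝ} (hat : a ≤ t)
    (h : ∀ s ∈ Icc a t, |f s| ≤ b s) :
    |∫ s in a..t, K (c - s) * f s| ≤ ∫ s in a..t, K (c - s) * b s := by
  refine (intervalIntegral.abs_integral_le_integral_abs hat).trans ?_
  refine intervalIntegral.integral_mono_on hat
    (Continuous.intervalIntegrable (by fun_prop) _ _)
    (Continuous.intervalIntegrable (by fun_prop) _ _) fun s hs => ?_
  rw [abs_mul, abs_of_nonneg (hK0 _)]
  exact mul_le_mul_of_nonneg_left (h s hs) (hK0 _)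

theorem abs_convolution_le_const (hK : Continuous K) (hK0 : ∀ t, 0 ≤ K t)
    (hKθ : ∀ t, 0 ≤ t → ∫ s in (0 : ℝ)..t, K s ≤ θ)
    {f : ℝ → ℝ} (hf : Continuous f) {B t : ℝ} (hB : 0 ≤ B) (ht : 0 ≤ t)
    (h : ∀ s ∈ Icc 0 t, |f s| ≤ B) :
    |∫ s in (0 : ℝ)..t, K (t - s) * f s| ≤ θ * B := by
  refine (abs_convolution_le hK hK0 hf (continuous_const (y := B)) ht h).trans ?_
  rw [integral_convolution_comm K (fun _ => B), intervalIntegral.integral_mul_const]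
  exact mul_le_mul_of_nonneg_right (hKθ t ht) hB

theorem continuous_convolution (hK : Continuous K) {f : ℝ → ℝ} (hf : Continuous f) :
    Continuous fun t => ∫ s in (0 : ℝ)..t, K (t - s) * f s :=
  intervalIntegral.continuous_parametric_intervalIntegral_of_continuous
    (f := fun t s => K (t - s) * f s) (by fun_prop) continuous_id

/-- Banach fixed point on bounded continuous functions. As the kernel has mass at most `θ < 1`, no
weight in the norm is needed. -/
theorem exists_continuous_volterra_solution (hK : Continuous K) (hK0 : ∀ t, 0 ≤ K t)
    (hθ : θ < 1) (hKθ : ∀ t, 0 ≤ t → ∫ s in (0 : ℝ)..t, K s ≤ θ)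
    (hz : Continuous z) {C : ℝ} (hzC : ∀ t, 0 ≤ t → |z t| ≤ C) :
    ∃ ψ : ℝ → ℝ, Continuous ψ ∧
      ∀ t, 0 ≤ t → ψ t = z t + ∫ s in (0 : ℝ)..t, K (t - s) * ψ s := by
  have hθ0 : 0 ≤ θ := by simpa using hKθ 0 le_rfl
  have hmax : Continuous fun t : ℝ => max t 0 := by fun_prop
  -- Freezing the time at `max t 0` extends the operator to all of `ℝ` while leaving it unchanged
  -- for `t ≥ 0`.
  let T : BoundedContinuousFunction ℝ ℝ → BoundedContinuousFunction ℝ ℝ := fun f =>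
    BoundedContinuousFunction.ofNormedAddCommGroup
      (fun t => z (max t 0) + ∫ s in (0 : ℝ)..(max t 0), K (max t 0 - s) * f s)
      ((hz.comp hmax).add ((continuous_convolution hK f.continuous).comp hmax))
      (C + θ * ‖f‖) fun t => by
        refine (abs_add_le _ _).trans (add_le_add (hzC _ (le_max_right _ _)) ?_)
        exact abs_convolution_le_const hK hK0 hKθ f.continuous (norm_nonneg _) (le_max_right _ _)
          fun s _ => f.norm_coe_le_norm s
  have hT : ContractingWith ⟨θ, hθ0⟩ T := by
    refine ⟨by exact_mod_cast hθ, LipschitzWith.of_dist_le_mul fun f g => ?_⟩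
    refine (BoundedContinuousFunction.dist_le (by positivity)).2 fun t => ?_
    have e : T f t - T g t = ∫ s in (0 : ℝ)..(max t 0), K (max t 0 - s) * (f s - g s) := by
      change (z (max t 0) + ∫ s in (0 : ℝ)..(max t 0), K (max t 0 - s) * f s) -
        (z (max t 0) + ∫ s in (0 : ℝ)..(max t 0), K (max t 0 - s) * g s) = _
      rw [add_sub_add_left_eq_sub, ← intervalIntegral.integral_sub
        (Continuous.intervalIntegrable (by fun_prop) _ _)
        (Continuous.intervalIntegrable (by fun_prop) _ _)]
      simp only [mul_sub]
    rw [Real.dist_eq, e]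
    refine abs_convolution_le_const hK hK0 hKθ (f := fun s => f s - g s) (by fun_prop)
      dist_nonneg (le_max_right _ _) fun s _ => ?_
    simpa [Real.dist_eq] using BoundedContinuousFunction.dist_coe_le_dist (f := f) (g := g) s
  have hfix := hT.fixedPoint_isFixedPt
  set ψ := hT.fixedPoint
  refine ⟨ψ, ψ.continuous, fun t ht => ?_⟩
  have h1 : (T ψ) t = ψ t := by rw [hfix]
  rw [← h1]
  change z (max t 0) + (∫ s in (0 : ℝ)..(max t 0), K (max t 0 - s) * _) = _
  rw [max_eq_left ht]

/-- Local integrability is first upgraded by the equation to a bound `B` on `[0,T]`, the kernel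
being bounded there. Each further use of the equation gains a factor `θ`. -/
theorem volterra_homogeneous_eq_zero (hK : Continuous K) (hK0 : ∀ t, 0 ≤ K t)
    (hθ : θ < 1) (hKθ : ∀ t, 0 ≤ t → ∫ s in (0 : ℝ)..t, K s ≤ θ)
    {δ : ℝ → ℝ} (hδ : LocallyIntegrableOn δ (Ici 0) volume)
    (heq : ∀ t, 0 ≤ t → δ t = ∫ s in (0 : ℝ)..t, K (t - s) * δ s) {T : ℝ} (hT : 0 ≤ T) :
    δ T = 0 := by
  have hθ0 : 0 ≤ θ := by simpa using hKθ 0 le_rfl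
  have hint : ∀ t, 0 ≤ t → IntervalIntegrable δ volume 0 t := fun t ht => by
    rw [intervalIntegrable_iff_integrableOn_Icc_of_le ht]
    exact hδ.integrableOn_compact_subset Icc_subset_Ici_self isCompact_Icc
  obtain ⟨c, hc⟩ := isCompact_Icc.exists_bound_of_continuousOn (s := Icc 0 T) hK.continuousOn
  have hc0 : 0 ≤ c := (norm_nonneg _).trans (hc 0 ⟨le_rfl, hT⟩)
  have hmul : ∀ t, 0 ≤ t → IntervalIntegrable (fun s => K (t - s) * |δ s|) volume 0 t :=
    fun t ht => (hint t ht).abs.continuousOn_mul (Continuous.continuousOn (by fun_prop))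
  have habs : ∀ t, 0 ≤ t → |δ t| ≤ ∫ s in (0 : ℝ)..t, K (t - s) * |δ s| := fun t ht => by
    conv_lhs => rw [heq t ht]
    refine (intervalIntegral.abs_integral_le_integral_abs ht).trans (le_of_eq ?_)
    refine intervalIntegral.integral_congr fun s _ => ?_
    simp only [abs_mul, abs_of_nonneg (hK0 _)]
  set B : ℝ := c * ∫ s in (0 : ℝ)..T, |δ s|
  have hB : ∀ t ∈ Icc 0 T, |δ t| ≤ B := fun t ht => by
    refine (habs t ht.1).trans ?_
    calc ∫ s in (0 : ℝ)..t, K (t - s) * |δ s| ≤ ∫ s in (0 : ℝ)..t, c * |δ s| := by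
          refine intervalIntegral.integral_mono_on ht.1 (hmul t ht.1)
            ((hint t ht.1).abs.const_mul c) fun s hs => ?_
          refine mul_le_mul_of_nonneg_right ?_ (abs_nonneg _)
          exact (le_abs_self _).trans (hc _ ⟨by linarith [hs.2], by linarith [hs.1, ht.2]⟩)
      _ = c * ∫ s in (0 : ℝ)..t, |δ s| := intervalIntegral.integral_const_mul _ _
      _ ≤ B := by
          refine mul_le_mul_of_nonneg_left ?_ hc0
          exact intervalIntegral.integral_mono_interval le_rfl ht.1 ht.2
            (Eventually.of_forall fun s => abs_nonneg _) (hint T hT).abs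
  have hB0 : 0 ≤ B := (abs_nonneg _).trans (hB T ⟨hT, le_rfl⟩)
  have hn : ∀ n : ℕ, ∀ t ∈ Icc 0 T, |δ t| ≤ θ ^ n * B := by
    intro n
    induction n with
    | zero => simpa using hB
    | succ n ih =>
      intro t ht
      refine (habs t ht.1).trans ?_
      calc ∫ s in (0 : ℝ)..t, K (t - s) * |δ s|
          ≤ ∫ s in (0 : ℝ)..t, K (t - s) * (θ ^ n * B) := by
            refine intervalIntegral.integral_mono_on ht.1 (hmul t ht.1)
              (Continuous.intervalIntegrable (by fun_prop) _ _) fun s hs => ?_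
            exact mul_le_mul_of_nonneg_left (ih s ⟨hs.1, hs.2.trans ht.2⟩) (hK0 _)
        _ ≤ θ * (θ ^ n * B) := by
            rw [integral_convolution_comm K (fun _ => θ ^ n * B),
              intervalIntegral.integral_mul_const]
            exact mul_le_mul_of_nonneg_right (hKθ t ht.1) (by positivity)
        _ = θ ^ (n + 1) * B := by ring
  have hlim : Tendsto (fun n : ℕ => θ ^ n * B) atTop (𝓝 0) := by
    simpa using (tendsto_pow_atTop_nhds_zero_of_lt_one hθ0 hθ).mul_const B
  exact abs_nonpos_iff.1 (ge_of_tendsto' hlim fun n => hn n T ⟨hT, le_rfl⟩)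

end Existence

/-! ### Subexponential asymptotics of Volterra convolutions. -/

section Asymptotics

variable {K g : ℝ → ℝ} {θ : ℝ}

/-- The lower bound is immediate, since `g(t-s) ≥ g(t)`. For the upper bound the convolution is cut
at `a` and `t/2`: on `[0,a]` the shift is negligible by `hlong`, on `[a,t/2]` the remaining kernel
mass is small and doubling applies, and on `[t/2,t]` one has `K ≤ K(t/2)` and `htail` applies. -/
theorem tendsto_convolution_div (hK : Continuous K) (hK0 : ∀ t, 0 ≤ K t) (hKa : Antitone K)
    (hKθ : ∀ t, 0 ≤ t → ∫ s in (0 : ℝ)..t, K s ≤ θ)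
    (hKlim : Tendsto (fun t => ∫ s in (0 : ℝ)..t, K s) atTop (𝓝 θ))
    (hg : Continuous g) (hg0 : ∀ t, 0 < g t) (hga : Antitone g)
    {C : ℝ} (hdouble : ∀ᶠ t in atTop, g (t / 2) ≤ C * g t)
    (hlong : ∀ a, 0 ≤ a → Tendsto (fun t => g (t - a) / g t) atTop (𝓝 1))
    (htail : Tendsto (fun t => K t * (∫ s in (0 : ℝ)..t, g s) / g t) atTop (𝓝 0)) :
    Tendsto (fun t => (∫ s in (0 : ℝ)..t, K (t - s) * g s) / g t) atTop (𝓝 θ) := by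
  have hθ0 : 0 ≤ θ := by simpa using hKθ 0 le_rfl
  obtain ⟨t₀, ht₀⟩ := hdouble.exists
  have hC0 : 0 ≤ C := by
    by_contra h
    nlinarith [hg0 (t₀ / 2), hg0 t₀]
  have hKi : ∀ a b, IntervalIntegrable K volume a b := fun a b => hK.intervalIntegrable _ _
  have hhalf : Tendsto (fun t : ℝ => t / 2) atTop atTop :=
    tendsto_id.atTop_div_const two_pos
  refine tendsto_order.2 ⟨fun b hb => ?_, fun b hb => ?_⟩
  · filter_upwards [(tendsto_order.1 hKlim).1 b hb, eventually_ge_atTop 0] with t ht ht0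
    refine ht.trans_le ?_
    rw [le_div_iff₀ (hg0 t), integral_convolution_comm, ← intervalIntegral.integral_mul_const]
    refine intervalIntegral.integral_mono_on ht0
      (Continuous.intervalIntegrable (by fun_prop) _ _)
      (Continuous.intervalIntegrable (by fun_prop) _ _) fun s hs => ?_
    exact mul_le_mul_of_nonneg_left (hga (by linarith [hs.1])) (hK0 _)
  · set ε := (b - θ) / 2 with hε
    have hεpos : 0 < ε := by linarith
    have h1 : ∀ᶠ a in atTop, C * (θ - ∫ s in (0 : ℝ)..a, K s) < ε := by
      have : Tendsto (fun a => C * (θ - ∫ s in (0 : ℝ)..a, K s)) atTop (𝓝 (C * (θ - θ))) :=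
        (hKlim.const_sub θ).const_mul C
      exact (tendsto_order.1 this).2 ε (by simpa using hεpos)
    -- The cut `a` is fixed before `t`, so that the kernel mass beyond it costs less than `ε` even
    -- after multiplication by the doubling constant.
    obtain ⟨a, ha, ha0⟩ := (h1.and (eventually_ge_atTop 0)).exists
    have hlim : Tendsto (fun t => θ * (g (t - a) / g t) +
        C * (K (t / 2) * (∫ s in (0 : ℝ)..(t / 2), g s) / g (t / 2))) atTop
        (𝓝 (θ * 1 + C * 0)) :=
      ((hlong a ha0).const_mul θ).add ((htail.comp hhalf).const_mul C)
    filter_upwards [(tendsto_order.1 hlim).2 (θ + ε) (by linarith), hdouble,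
      eventually_ge_atTop (2 * a)] with t ht htd hta
    have hgt := hg0 t
    have hfi : ∀ a b, IntervalIntegrable (fun s => K s * g (t - s)) volume a b := fun a b =>
      Continuous.intervalIntegrable (by fun_prop) _ _
    have hsplit : ∫ s in (0 : ℝ)..t, K s * g (t - s) =
        (∫ s in (0 : ℝ)..a, K s * g (t - s)) + (∫ s in a..(t / 2), K s * g (t - s)) +
          ∫ s in (t / 2)..t, K s * g (t - s) := by
      rw [intervalIntegral.integral_add_adjacent_intervals (hfi _ _) (hfi _ _),
        intervalIntegral.integral_add_adjacent_intervals (hfi _ _) (hfi _ _)]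
    have e1 : ∫ s in (0 : ℝ)..a, K s * g (t - s) ≤ θ * g (t - a) := by
      refine le_trans ?_ (mul_le_mul_of_nonneg_right (hKθ a ha0) (hg0 _).le)
      rw [← intervalIntegral.integral_mul_const]
      refine intervalIntegral.integral_mono_on ha0 (hfi _ _) ((hKi _ _).mul_const _)
        fun s hs => ?_
      exact mul_le_mul_of_nonneg_left (hga (by linarith [hs.2])) (hK0 _)
    have e2 : ∫ s in a..(t / 2), K s * g (t - s) ≤ ε * g t := by
      have i1 : ∫ s in a..(t / 2), K s * g (t - s) ≤
          (∫ s in a..(t / 2), K s) * g (t / 2) := by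
        rw [← intervalIntegral.integral_mul_const]
        refine intervalIntegral.integral_mono_on (by linarith) (hfi _ _) ((hKi _ _).mul_const _)
          fun s hs => ?_
        exact mul_le_mul_of_nonneg_left (hga (by linarith [hs.2])) (hK0 _)
      have i2 : ∫ s in a..(t / 2), K s ≤ θ - ∫ s in (0 : ℝ)..a, K s := by
        have := intervalIntegral.integral_add_adjacent_intervals (hKi 0 a) (hKi a (t / 2))
        linarith [hKθ (t / 2) (by linarith)]
      have i3 : 0 ≤ θ - ∫ s in (0 : ℝ)..a, K s := by linarith [hKθ a ha0]
      calc _ ≤ (∫ s in a..(t / 2), K s) * g (t / 2) := i1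
        _ ≤ (θ - ∫ s in (0 : ℝ)..a, K s) * g (t / 2) :=
            mul_le_mul_of_nonneg_right i2 (hg0 _).le
        _ ≤ (θ - ∫ s in (0 : ℝ)..a, K s) * (C * g t) := mul_le_mul_of_nonneg_left htd i3
        _ = (C * (θ - ∫ s in (0 : ℝ)..a, K s)) * g t := by ring
        _ ≤ ε * g t := mul_le_mul_of_nonneg_right ha.le hgt.le
    have e3 : ∫ s in (t / 2)..t, K s * g (t - s) ≤
        K (t / 2) * ∫ s in (0 : ℝ)..(t / 2), g s := by
      have i1 : ∫ s in (t / 2)..t, K s * g (t - s) ≤ ∫ s in (t / 2)..t, K (t / 2) * g (t - s) := by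
        refine intervalIntegral.integral_mono_on (by linarith) (hfi _ _)
          (Continuous.intervalIntegrable (by fun_prop) _ _) fun s hs => ?_
        exact mul_le_mul_of_nonneg_right (hKa hs.1) (hg0 _).le
      refine i1.trans (le_of_eq ?_)
      rw [intervalIntegral.integral_const_mul,
        intervalIntegral.integral_comp_sub_left (fun s => g s) t]
      congr 2 <;> ring
    have e3' : K (t / 2) * (∫ s in (0 : ℝ)..(t / 2), g s) ≤
        C * (K (t / 2) * (∫ s in (0 : ℝ)..(t / 2), g s) / g (t / 2)) * g t := by
      have hX : 0 ≤ K (t / 2) * (∫ s in (0 : ℝ)..(t / 2), g s) / g (t / 2) :=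
        div_nonneg (mul_nonneg (hK0 _) (intervalIntegral.integral_nonneg (by linarith)
          fun s _ => (hg0 s).le)) (hg0 _).le
      calc K (t / 2) * (∫ s in (0 : ℝ)..(t / 2), g s) =
          (K (t / 2) * (∫ s in (0 : ℝ)..(t / 2), g s) / g (t / 2)) * g (t / 2) :=
            (div_mul_cancel₀ _ (hg0 _).ne').symm
        _ ≤ (K (t / 2) * (∫ s in (0 : ℝ)..(t / 2), g s) / g (t / 2)) * (C * g t) :=
            mul_le_mul_of_nonneg_left htd hX
        _ = _ := by ring
    have e1' : θ * g (t - a) = θ * (g (t - a) / g t) * g t := by field_simp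
    rw [div_lt_iff₀ hgt, integral_convolution_comm, hsplit]
    have := mul_lt_mul_of_pos_right ht hgt
    have hb' : b = θ + ε + ε := by rw [hε]; ring
    rw [hb']
    nlinarith

/-- Choose `q < 1` above `θ`, so that `K * g ≤ q g` eventually. A maximum argument gives `|e| ≤ B
g`; feeding such a bound back into the equation improves it by a fixed factor `p < 1` for large
times, and iteration gives `o(g)`. -/
theorem volterra_isLittleO (hK : Continuous K) (hK0 : ∀ t, 0 ≤ K t) (hKa : Antitone K)
    (hθ : θ < 1) (hg : Continuous g) (hg0 : ∀ t, 0 < g t)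
    (hconv : Tendsto (fun t => (∫ s in (0 : ℝ)..t, K (t - s) * g s) / g t) atTop (𝓝 θ))
    (hKg : ∀ a, 0 ≤ a → Tendsto (fun t => K (t - a) / g t) atTop (𝓝 0))
    {e ρ : ℝ → ℝ} (he : Continuous e)
    (heq : ∀ t, 0 ≤ t → e t = ρ t + ∫ s in (0 : ℝ)..t, K (t - s) * e s)
    (hρ : ρ =o[atTop] g) : e =o[atTop] g := by
  obtain ⟨q, hθq, hq1⟩ := exists_between (max_lt hθ one_pos)
  have hq0 : 0 < q := (le_max_right _ _).trans_lt hθq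
  have hA : ∀ᶠ t in atTop, ∫ s in (0 : ℝ)..t, K (t - s) * g s ≤ q * g t := by
    filter_upwards [(tendsto_order.1 hconv).2 q ((le_max_left _ _).trans_lt hθq)] with t ht
    exact ((div_lt_iff₀ (hg0 t)).1 ht).le
  have hρ' : ∀ c > 0, ∀ᶠ t in atTop, |ρ t| ≤ c * g t := fun c hc => by
    filter_upwards [hρ.def hc] with t ht
    simpa [abs_of_pos (hg0 t)] using ht
  obtain ⟨B, hB0, hB⟩ : ∃ B, 0 < B ∧ ∀ t, 0 ≤ t → |e t| ≤ B * g t := by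
    obtain ⟨T, hT⟩ := eventually_atTop.1 (hA.and ((hρ' 1 one_pos).and (eventually_ge_atTop 0)))
    have hT0 : 0 ≤ T := (hT T le_rfl).2.2
    have hcont : Continuous fun t => |e t| / g t := he.abs.div hg fun t => (hg0 t).ne'
    obtain ⟨b, hb⟩ := isCompact_Icc.exists_bound_of_continuousOn (s := Icc 0 T) hcont.continuousOn
    refine ⟨max b (1 / (1 - q)), lt_max_of_lt_right (by
      apply one_div_pos.2; linarith), fun t ht => ?_⟩
    -- At a maximum point `m ≥ T` of `|e|/g` the equation gives `x ≤ 1 + q x` for the value `x = |e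
    -- m|/g m`, hence `x ≤ 1/(1-q)`; for `m ≤ T` compactness suffices.
    obtain ⟨m, hm, hmax⟩ := isCompact_Icc.exists_isMaxOn (s := Icc 0 t) ⟨0, le_rfl, ht⟩
      hcont.continuousOn
    have hmle : |e m| / g m ≤ max b (1 / (1 - q)) := by
      rcases le_total m T with hmT | hmT
      · exact ((le_abs_self _).trans (hb m ⟨hm.1, hmT⟩)).trans (le_max_left _ _)
      · refine le_trans ?_ (le_max_right _ _)
        obtain ⟨h1, h2, -⟩ := hT m hmT
        have h3 : |∫ s in (0 : ℝ)..m, K (m - s) * e s| ≤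
            ∫ s in (0 : ℝ)..m, K (m - s) * ((|e m| / g m) * g s) := by
          refine abs_convolution_le hK hK0 he (by fun_prop) hm.1 fun s hs => ?_
          rw [← div_le_iff₀ (hg0 s)]
          exact hmax ⟨hs.1, hs.2.trans hm.2⟩
        have h4 : ∫ s in (0 : ℝ)..m, K (m - s) * ((|e m| / g m) * g s) =
            (|e m| / g m) * ∫ s in (0 : ℝ)..m, K (m - s) * g s := by
          rw [← intervalIntegral.integral_const_mul]
          exact intervalIntegral.integral_congr fun s _ => by ring
        have h5 : |e m| ≤ 1 * g m + (|e m| / g m) * (q * g m) := by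
          conv_lhs => rw [heq m hm.1]
          refine (abs_add_le _ _).trans (add_le_add h2 (h3.trans ?_))
          rw [h4]
          exact mul_le_mul_of_nonneg_left h1 (div_nonneg (abs_nonneg _) (hg0 _).le)
        have h6 : |e m| / g m ≤ 1 + (|e m| / g m) * q := by
          rw [div_le_iff₀ (hg0 m)]
          linarith
        rw [le_div_iff₀ (by linarith)]
        linarith
    rw [← div_le_iff₀ (hg0 t)]
    exact (hmax ⟨ht, le_rfl⟩).trans hmle
  obtain ⟨p, hqp, hp1⟩ := exists_between hq1
  have hp0 : 0 < p := hq0.trans hqp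
  have hstep : ∀ n : ℕ, ∀ᶠ t in atTop, |e t| ≤ p ^ n * B * g t := by
    intro n
    induction n with
    | zero =>
      filter_upwards [eventually_ge_atTop 0] with t ht
      simpa using hB t ht
    | succ n ih =>
      -- The slack `p - q` is shared equally between `ρ` and the part of the convolution over
      -- `[0,T]`, where only the crude bound `B g` is known but `K(t-T) = o(g(t))`. The part over
      -- `[T,t]` contributes `q`.
      have hc : 0 < (p - q) / 2 * (p ^ n * B) := by
        have : 0 < p - q := by linarith
        positivity
      obtain ⟨T, hT⟩ := eventually_atTop.1 (ih.and (eventually_ge_atTop 0))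
      have hT0 : 0 ≤ T := (hT T le_rfl).2
      have hhead : ∀ᶠ t in atTop, (∫ s in (0 : ℝ)..T, B * g s) * (K (t - T) / g t) <
          (p - q) / 2 * (p ^ n * B) := by
        have := (hKg T hT0).const_mul (∫ s in (0 : ℝ)..T, B * g s)
        exact (tendsto_order.1 this).2 _ (by simpa using hc)
      filter_upwards [hA, hρ' _ hc, hhead, eventually_ge_atTop T] with t h1 h2 h3 htT
      have hei : ∀ a b, IntervalIntegrable (fun s => K (t - s) * e s) volume a b := fun a b =>
        Continuous.intervalIntegrable (by fun_prop) _ _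
      have hgi : ∀ a b, IntervalIntegrable (fun s => K (t - s) * g s) volume a b := fun a b =>
        Continuous.intervalIntegrable (by fun_prop) _ _
      have i1 : |∫ s in (0 : ℝ)..T, K (t - s) * e s| ≤ (p - q) / 2 * (p ^ n * B) * g t := by
        refine (abs_convolution_le hK hK0 he (b := fun s => B * g s) (by fun_prop) hT0
          fun s hs => hB s hs.1).trans ?_
        have : ∫ s in (0 : ℝ)..T, K (t - s) * (B * g s) ≤
            K (t - T) * ∫ s in (0 : ℝ)..T, B * g s := by
          rw [← intervalIntegral.integral_const_mul]
          refine intervalIntegral.integral_mono_on hT0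
            (Continuous.intervalIntegrable (by fun_prop) _ _)
            (Continuous.intervalIntegrable (by fun_prop) _ _) fun s hs => ?_
          exact mul_le_mul_of_nonneg_right (hKa (by linarith [hs.2]))
            (mul_nonneg hB0.le (hg0 s).le)
        refine this.trans ?_
        rw [← div_le_iff₀ (hg0 t)]
        refine le_trans (le_of_eq ?_) h3.le
        ring
      have i2 : |∫ s in T..t, K (t - s) * e s| ≤ p ^ n * B * (q * g t) := by
        refine (abs_convolution_le hK hK0 he (b := fun s => p ^ n * B * g s) (by fun_prop) htT
          fun s hs => (hT s hs.1).1).trans ?_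
        have e1 : ∫ s in T..t, K (t - s) * (p ^ n * B * g s) =
            p ^ n * B * ∫ s in T..t, K (t - s) * g s := by
          rw [← intervalIntegral.integral_const_mul]
          exact intervalIntegral.integral_congr fun s _ => by ring
        rw [e1]
        refine mul_le_mul_of_nonneg_left (le_trans ?_ h1) (by positivity)
        rw [← intervalIntegral.integral_add_adjacent_intervals (hgi 0 T) (hgi T t)]
        linarith [intervalIntegral.integral_nonneg hT0
          (f := fun s => K (t - s) * g s) (μ := volume) fun s _ => mul_nonneg (hK0 _) (hg0 s).le]
      rw [heq t (hT0.trans htT),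
        ← intervalIntegral.integral_add_adjacent_intervals (hei 0 T) (hei T t)]
      calc _ ≤ |ρ t| + (|∫ s in (0 : ℝ)..T, K (t - s) * e s| +
              |∫ s in T..t, K (t - s) * e s|) :=
            (abs_add_le _ _).trans (add_le_add le_rfl (abs_add_le _ _))
        _ ≤ (p - q) / 2 * (p ^ n * B) * g t + ((p - q) / 2 * (p ^ n * B) * g t +
              p ^ n * B * (q * g t)) := add_le_add h2 (add_le_add i1 i2)
        _ = p ^ (n + 1) * B * g t := by ring
  refine isLittleO_iff.2 fun c hc => ?_
  have hlim : Tendsto (fun n : ℕ => p ^ n * B) atTop (𝓝 0) := by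
    simpa using (tendsto_pow_atTop_nhds_zero_of_lt_one hp0.le hp1).mul_const B
  obtain ⟨n, hn⟩ := ((tendsto_order.1 hlim).2 c hc).exists
  filter_upwards [hstep n] with t ht
  rw [Real.norm_eq_abs, Real.norm_eq_abs, abs_of_pos (hg0 t)]
  exact ht.trans (mul_le_mul_of_nonneg_right hn.le (hg0 t).le)

/-- With `l = c/(1-θ)`, the difference `u - l g` solves the equation with forcing `w - l g + l (K *
g)`. Divided by `g`, this tends to `c - l + l θ = 0`. -/
theorem volterra_tendsto_div (hK : Continuous K) (hK0 : ∀ t, 0 ≤ K t) (hKa : Antitone K)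
    (hθ : θ < 1) (hg : Continuous g) (hg0 : ∀ t, 0 < g t)
    (hconv : Tendsto (fun t => (∫ s in (0 : ℝ)..t, K (t - s) * g s) / g t) atTop (𝓝 θ))
    (hKg : ∀ a, 0 ≤ a → Tendsto (fun t => K (t - a) / g t) atTop (𝓝 0))
    {u w : ℝ → ℝ} (hu : Continuous u)
    (heq : ∀ t, 0 ≤ t → u t = w t + ∫ s in (0 : ℝ)..t, K (t - s) * u s)
    {c : ℝ} (hw : Tendsto (fun t => w t / g t) atTop (𝓝 c)) :
    Tendsto (fun t => u t / g t) atTop (𝓝 (c / (1 - θ))) := by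
  set l := c / (1 - θ) with hl
  have hcl : c - l + l * θ = 0 := by
    have : 1 - θ ≠ 0 := by linarith
    rw [hl]; field_simp; ring
  have key : (fun t => u t - l * g t) =o[atTop] g := by
    refine volterra_isLittleO hK hK0 hKa hθ hg hg0 hconv hKg
      (ρ := fun t => w t - l * g t + l * ∫ s in (0 : ℝ)..t, K (t - s) * g s)
      (by fun_prop) (fun t ht => ?_) ?_
    · have : ∫ s in (0 : ℝ)..t, K (t - s) * (u s - l * g s) =
          (∫ s in (0 : ℝ)..t, K (t - s) * u s) - l * ∫ s in (0 : ℝ)..t, K (t - s) * g s := by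
        rw [← intervalIntegral.integral_const_mul, ← intervalIntegral.integral_sub
          (Continuous.intervalIntegrable (by fun_prop) _ _)
          (Continuous.intervalIntegrable (by fun_prop) _ _)]
        exact intervalIntegral.integral_congr fun s _ => by ring
      rw [this, heq t ht]; ring
    · rw [isLittleO_iff_tendsto' (Eventually.of_forall fun t h => absurd h (hg0 t).ne')]
      have hlim := (hw.sub_const l).add (hconv.const_mul l)
      rw [hcl] at hlim
      refine hlim.congr fun t => ?_
      have := (hg0 t).ne'
      field_simp
  have := (isLittleO_iff_tendsto' (Eventually.of_forall fun t h => absurd h (hg0 t).ne')).1 key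
  have h2 := this.add_const l
  rw [zero_add] at h2
  refine h2.congr fun t => ?_
  have := (hg0 t).ne'
  field_simp
  ring

end Asymptotics


/-- Cutting at `√s` bounds the integral by `√s g(0) + s g(√s)`. -/
theorem tendsto_average_of_antitone {g : ℝ → ℝ} (hg : Continuous g) (hga : Antitone g)
    (hlim : Tendsto g atTop (𝓝 0)) :
    Tendsto (fun s => (∫ x in (0 : ℝ)..s, g x) / s) atTop (𝓝 0) := by
  have hg0 : ∀ t, 0 ≤ g t := fun t => hga.le_of_tendsto hlim t
  have hup : Tendsto (fun s => g 0 / √s + g √s) atTop (𝓝 0) := by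
    have h1 := Real.tendsto_sqrt_atTop
    simpa using (tendsto_const_nhds.div_atTop h1).add (hlim.comp h1)
  refine tendsto_of_tendsto_of_tendsto_of_le_of_le' tendsto_const_nhds hup ?_ ?_
  · filter_upwards [eventually_ge_atTop 0] with s hs
    exact div_nonneg (intervalIntegral.integral_nonneg hs fun x _ => hg0 x) hs
  · filter_upwards [eventually_ge_atTop 1] with s hs
    have hs0 : 0 < s := by linarith
    have hq0 : 0 < √s := Real.sqrt_pos.2 hs0
    have hqs : √s * √s = s := Real.mul_self_sqrt hs0.le
    have hq1 : √s ≤ s := by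
      have : 1 ≤ √s := Real.one_le_sqrt.2 hs
      nlinarith
    have hi : ∀ a b, IntervalIntegrable g volume a b := fun a b => hg.intervalIntegrable _ _
    have h1 : ∫ x in (0 : ℝ)..√s, g x ≤ √s * g 0 := by
      have := intervalIntegral.integral_mono_on hq0.le (hi 0 √s)
        (intervalIntegrable_const (c := g 0)) fun x hx => hga hx.1
      simpa using this
    have h2 : ∫ x in √s..s, g x ≤ s * g √s := by
      have := intervalIntegral.integral_mono_on hq1 (hi √s s)
        (intervalIntegrable_const (c := g √s)) fun x hx => hga hx.1
      rw [intervalIntegral.integral_const, smul_eq_mul] at this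
      nlinarith [hg0 √s]
    rw [div_le_iff₀ hs0, ← intervalIntegral.integral_add_adjacent_intervals (hi 0 √s) (hi √s s)]
    have h3 : (g 0 / √s + g √s) * s = √s * g 0 + s * g √s := by
      have : g 0 / √s * s = √s * g 0 := by
        rw [div_mul_eq_mul_div, div_eq_iff hq0.ne', mul_right_comm, hqs, mul_comm]
      rw [add_mul, this, mul_comm (g √s)]
    rw [h3]
    exact add_le_add h1 h2

/-! ### The transforms `H_k` satisfy the subexponential hypotheses. -/

section LaplaceMomentAsymptotics

variable {ν : Measure ℝ} [IsFiniteMeasure ν] {M : ℝ} {k : ℕ} {C : ℝ}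

theorem exists_mul_laplaceMoment_succ_le (hν : ∀ᵐ x ∂ν, x ∈ Ioc 0 M)
    (hC : ∃ C, 0 < C ∧ ∀ᶠ s in atTop, laplaceMoment ν k (s / 2) ≤ C * laplaceMoment ν k s) :
    ∃ C, 0 < C ∧ ∀ᶠ s in atTop, s * laplaceMoment ν (k + 1) s ≤ C * laplaceMoment ν k s := by
  obtain ⟨C, hC0, hC⟩ := hC
  refine ⟨2 * C, by positivity, ?_⟩
  filter_upwards [hC] with s hs
  linarith [mul_laplaceMoment_succ_le hν k s]

theorem tendsto_laplaceMoment_succ_div (hν : ∀ᵐ x ∂ν, x ∈ Ioc 0 M) (h0 : ν ≠ 0)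
    (hC : ∃ C, 0 < C ∧ ∀ᶠ s in atTop, laplaceMoment ν k (s / 2) ≤ C * laplaceMoment ν k s) :
    Tendsto (fun s => laplaceMoment ν (k + 1) s / laplaceMoment ν k s) atTop (𝓝 0) := by
  obtain ⟨C, hC0, hC⟩ := exists_mul_laplaceMoment_succ_le hν hC
  refine tendsto_of_tendsto_of_tendsto_of_le_of_le' tendsto_const_nhds
    (tendsto_const_nhds.div_atTop tendsto_id : Tendsto (fun s : ℝ => C / s) atTop (𝓝 0)) ?_ ?_
  · exact Eventually.of_forall fun s =>
      div_nonneg (laplaceMoment_nonneg hν _ s) (laplaceMoment_nonneg hν _ s)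
  · filter_upwards [hC, eventually_gt_atTop 0] with s hs hs0
    rw [div_le_div_iff₀ (laplaceMoment_pos hν h0 k s) hs0, mul_comm]
    exact hs

/-- The inverse ratio lies between `1 - a H_{k+1}(s-a)/H_k(s-a)` and `1`, and the quotient of
consecutive moments vanishes at infinity. -/
theorem tendsto_laplaceMoment_sub_div (hν : ∀ᵐ x ∂ν, x ∈ Ioc 0 M) (h0 : ν ≠ 0)
    (hC : ∃ C, 0 < C ∧ ∀ᶠ s in atTop, laplaceMoment ν k (s / 2) ≤ C * laplaceMoment ν k s)
    {a : ℝ} (ha : 0 ≤ a) :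
    Tendsto (fun s => laplaceMoment ν k (s - a) / laplaceMoment ν k s) atTop (𝓝 1) := by
  have h1 := ((tendsto_laplaceMoment_succ_div hν h0 hC).comp
    (tendsto_atTop_add_const_right atTop (-a) tendsto_id)).const_mul a
  have h2 := h1.const_sub 1
  rw [mul_zero, sub_zero] at h2
  have h3 : Tendsto (fun s => laplaceMoment ν k s / laplaceMoment ν k (s - a)) atTop (𝓝 1) := by
    refine tendsto_of_tendsto_of_tendsto_of_le_of_le h2 tendsto_const_nhds (fun s => ?_)
      fun s => ?_
    · have hp := laplaceMoment_pos hν h0 k (s - a)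
      simp only [Function.comp_apply, id_eq, ← sub_eq_add_neg]
      rw [le_div_iff₀ hp]
      have e : (1 - a * (laplaceMoment ν (k + 1) (s - a) / laplaceMoment ν k (s - a))) *
          laplaceMoment ν k (s - a) =
          laplaceMoment ν k (s - a) - a * laplaceMoment ν (k + 1) (s - a) := by
        field_simp
      rw [e]
      linarith [laplaceMoment_sub_le hν k s a]
    · exact div_le_one_of_le₀ (antitone_laplaceMoment hν k (by linarith))
        (laplaceMoment_nonneg hν k _)
  simpa using h3.inv₀ one_ne_zero

/-- By `hC` the quantity is at most `C` times the average of `H_k` over `[0,s]`, so integrability of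
`H_k` at infinity is not needed. -/
theorem tendsto_laplaceMoment_two_mul_integral_div (hν : ∀ᵐ x ∂ν, x ∈ Ioc 0 M) (h0 : ν ≠ 0)
    (hC : ∃ C, 0 < C ∧ ∀ᶠ s in atTop, s * laplaceMoment ν 2 s ≤ C * laplaceMoment ν k s) :
    Tendsto (fun s => laplaceMoment ν 2 s * (∫ x in (0 : ℝ)..s, laplaceMoment ν k x) /
      laplaceMoment ν k s) atTop (𝓝 0) := by
  obtain ⟨C, hC0, hC⟩ := hC
  have h1 := (tendsto_average_of_antitone (continuous_laplaceMoment hν k)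
    (antitone_laplaceMoment hν k) (tendsto_laplaceMoment_atTop hν k)).const_mul C
  rw [mul_zero] at h1
  have hI : ∀ s, 0 ≤ s → 0 ≤ ∫ x in (0 : ℝ)..s, laplaceMoment ν k x := fun s hs =>
    intervalIntegral.integral_nonneg hs fun x _ => laplaceMoment_nonneg hν k x
  refine tendsto_of_tendsto_of_tendsto_of_le_of_le' tendsto_const_nhds h1 ?_ ?_
  · filter_upwards [eventually_ge_atTop 0] with s hs
    exact div_nonneg (mul_nonneg (laplaceMoment_nonneg hν _ s) (hI s hs))
      (laplaceMoment_nonneg hν _ s)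
  · filter_upwards [hC, eventually_gt_atTop 0] with s hs hs0
    rw [← mul_div_assoc, div_le_div_iff₀ (laplaceMoment_pos hν h0 k s) hs0]
    nlinarith [mul_le_mul_of_nonneg_right hs (hI s hs0.le)]

variable {κ c : ℝ}

theorem integral_laplaceMoment_comp_mul (hν : ∀ᵐ x ∂ν, x ∈ Ioc 0 M) (k : ℕ) (hc : 0 < c) (t : ℝ) :
    ∫ s in (0 : ℝ)..t, laplaceMoment ν (k + 1) (c * s) =
      c⁻¹ * (laplaceMoment ν k 0 - laplaceMoment ν k (c * t)) := by
  rw [intervalIntegral.integral_comp_mul_left _ hc.ne', mul_zero, integral_laplaceMoment hν,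
    smul_eq_mul]

/-- Solutions of the Volterra equation with kernel `κ H₂(ct)`, forced by `w ∼ a H_k(ct)`,
satisfy `u ∼ a / (1 - θ) H_k(ct)`. -/
theorem laplaceMoment_volterra_tendsto_div (hν : ∀ᵐ x ∂ν, x ∈ Ioc 0 M) (h0 : ν ≠ 0)
    (hκ : 0 ≤ κ) (hc : 0 < c) (hθ : κ * (c⁻¹ * laplaceMoment ν 1 0) < 1)
    (hC : ∃ C, 0 < C ∧ ∀ᶠ s in atTop, laplaceMoment ν k (s / 2) ≤ C * laplaceMoment ν k s)
    (hC2 : ∃ C, 0 < C ∧ ∀ᶠ s in atTop, s * laplaceMoment ν 2 s ≤ C * laplaceMoment ν k s)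
    {u w : ℝ → ℝ} (hu : Continuous u)
    (heq : ∀ t, 0 ≤ t →
      u t = w t + ∫ s in (0 : ℝ)..t, κ * laplaceMoment ν 2 (c * (t - s)) * u s)
    {a : ℝ} (hw : Tendsto (fun t => w t / laplaceMoment ν k (c * t)) atTop (𝓝 a)) :
    Tendsto (fun t => u t / laplaceMoment ν k (c * t)) atTop
      (𝓝 (a / (1 - κ * (c⁻¹ * laplaceMoment ν 1 0)))) := by
  have hct : Tendsto (fun t => c * t) atTop atTop := tendsto_id.const_mul_atTop hc
  have hcm : Monotone fun t => c * t := fun x y hxy => mul_le_mul_of_nonneg_left hxy hc.le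
  have hH := fun k => continuous_laplaceMoment hν k
  have hK : Continuous fun t => κ * laplaceMoment ν 2 (c * t) :=
    continuous_const.mul ((hH 2).comp (continuous_const.mul continuous_id))
  have hK0 : ∀ t, 0 ≤ κ * laplaceMoment ν 2 (c * t) := fun t =>
    mul_nonneg hκ (laplaceMoment_nonneg hν _ _)
  have hKa : Antitone fun t => κ * laplaceMoment ν 2 (c * t) := fun x y hxy =>
    mul_le_mul_of_nonneg_left (antitone_laplaceMoment hν 2 (hcm hxy)) hκ
  have hKint : ∀ t, ∫ s in (0 : ℝ)..t, κ * laplaceMoment ν 2 (c * s) =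
      κ * (c⁻¹ * (laplaceMoment ν 1 0 - laplaceMoment ν 1 (c * t))) := fun t => by
    rw [intervalIntegral.integral_const_mul, integral_laplaceMoment_comp_mul hν 1 hc]
  have hg : Continuous fun t => laplaceMoment ν k (c * t) :=
    (hH k).comp (continuous_const.mul continuous_id)
  have hg0 : ∀ t, 0 < laplaceMoment ν k (c * t) := fun t => laplaceMoment_pos hν h0 k _
  have hga : Antitone fun t => laplaceMoment ν k (c * t) := fun x y hxy =>
    antitone_laplaceMoment hν k (hcm hxy)
  have hlong : ∀ b, 0 ≤ b →
      Tendsto (fun t => laplaceMoment ν k (c * (t - b)) / laplaceMoment ν k (c * t))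
        atTop (𝓝 1) := fun b hb => by
    have := (tendsto_laplaceMoment_sub_div hν h0 hC (mul_nonneg hc.le hb)).comp hct
    simpa only [Function.comp_def, ← mul_sub] using this
  have hKg : ∀ b, 0 ≤ b →
      Tendsto (fun t => κ * laplaceMoment ν 2 (c * (t - b)) / laplaceMoment ν k (c * t))
        atTop (𝓝 0) := fun b hb => by
    have h1 : Tendsto (fun s => laplaceMoment ν 2 s / laplaceMoment ν k s) atTop (𝓝 0) := by
      obtain ⟨C, hC0, hC2⟩ := hC2
      refine tendsto_of_tendsto_of_tendsto_of_le_of_le' tendsto_const_nhds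
        (tendsto_const_nhds.div_atTop tendsto_id : Tendsto (fun s : ℝ => C / s) atTop (𝓝 0)) ?_ ?_
      · exact Eventually.of_forall fun s =>
          div_nonneg (laplaceMoment_nonneg hν _ s) (laplaceMoment_nonneg hν _ s)
      · filter_upwards [hC2, eventually_gt_atTop 0] with s hs hs0
        rw [div_le_div_iff₀ (laplaceMoment_pos hν h0 k s) hs0, mul_comm]
        exact hs
    have h2 := h1.comp (hct.comp (tendsto_atTop_add_const_right atTop (-b) tendsto_id))
    -- Factor `H_2(c(t-b))/H_k(ct)` through `H_k(c(t-b))`.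
    have h3 := (h2.mul (hlong b hb)).const_mul κ
    rw [zero_mul, mul_zero] at h3
    refine h3.congr fun t => ?_
    have e1 := (hg0 t).ne'
    have e2 := (hg0 (t - b)).ne'
    simp only [Function.comp_apply, id_eq, ← sub_eq_add_neg]
    field_simp
  have hconv : Tendsto (fun t => (∫ s in (0 : ℝ)..t, κ * laplaceMoment ν 2 (c * (t - s)) *
      laplaceMoment ν k (c * s)) / laplaceMoment ν k (c * t)) atTop
      (𝓝 (κ * (c⁻¹ * laplaceMoment ν 1 0))) := by
    obtain ⟨C, hC0, hC⟩ := hC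
    refine tendsto_convolution_div hK hK0 hKa (fun t _ => ?_) ?_ hg hg0 hga (C := C) ?_ hlong ?_
    · rw [hKint]
      have := laplaceMoment_nonneg hν 1 (c * t)
      gcongr
      linarith
    · simp only [hKint]
      have := ((tendsto_laplaceMoment_atTop hν 1).comp hct).const_sub (laplaceMoment ν 1 0)
      rw [sub_zero] at this
      exact (this.const_mul c⁻¹).const_mul κ
    · filter_upwards [hct.eventually hC] with t ht
      rwa [← mul_div_assoc]
    · have h1 := ((tendsto_laplaceMoment_two_mul_integral_div hν h0 hC2).comp hct).const_mul
        (κ * c⁻¹)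
      rw [mul_zero] at h1
      refine h1.congr fun t => ?_
      rw [intervalIntegral.integral_comp_mul_left _ hc.ne', mul_zero, smul_eq_mul]
      simp only [Function.comp_apply]
      ring
  exact volterra_tendsto_div hK hK0 hKa hθ hg hg0 hconv hKg hu heq hw

end LaplaceMomentAsymptotics


theorem isEquivalent_of_tendsto_div {u g f : ℝ → ℝ} {b : ℝ} (hb : b ≠ 0)
    (hg : ∀ t, g t ≠ 0) (hu : Tendsto (fun t => u t / g t) atTop (𝓝 b)) (hgf : g ~[atTop] f) :
    u ~[atTop] fun t => b * f t := by
  have h1 := ((isEquivalent_const_iff_tendsto hb).2 hu).mul hgf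
  refine h1.congr_left (Eventually.of_forall fun t => ?_)
  exact div_mul_cancel₀ _ (hg t)

/-! ### From left-edge regularity of `μ` to the asymptotics of `h_k`. -/

section Problem

variable {μ : Measure ℝ} {M γ α : ℝ} {L : ℝ → ℝ}

theorem ae_restrict_Ioi_mem_Ioc (hM : μ (Icc 0 M)ᶜ = 0) :
    ∀ᵐ x ∂(μ.restrict (Ioi 0)), x ∈ Ioc 0 M := by
  have h1 : ∀ᵐ x ∂μ, x ∈ Icc 0 M := hM
  filter_upwards [ae_restrict_mem measurableSet_Ioi, ae_restrict_of_ae h1] with x hx hx'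
  exact ⟨hx, hx'.2⟩

theorem measureReal_restrict_Ioi_Iic (y : ℝ) :
    (μ.restrict (Ioi 0)).real (Iic y) = μ.real (Ioc 0 y) := by
  rw [measureReal_restrict_apply measurableSet_Iic, inter_comm, Ioi_inter_Iic]

/-- Division by zero gives `0`, so a zero of `L` would make the ratio for `x = 1` equal to `0`
instead of near `1`. -/
theorem SlowlyVarying.eventually_ne_zero (hL : SlowlyVarying L) : ∀ᶠ t in atTop, L t ≠ 0 := by
  filter_upwards [(hL 1 one_pos).eventually_ne one_ne_zero] with t ht h
  simp [h] at ht

theorem LeftEdgeRegular.isEquivalent (hreg : LeftEdgeRegular μ α L) (hedge : leftEdge μ = 0)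
    {v : ℝ} (hv : 0 < v) :
    (fun s => (μ.restrict (Ioi 0)).real (Iic (v / s))) ~[atTop]
      fun s => (v / s) ^ α * L (s * v⁻¹) := by
  have h1 := hreg.2
  simp only [hedge, zero_add] at h1
  have h2 : Tendsto (fun s : ℝ => v / s) atTop (𝓝[>] 0) := by
    refine tendsto_nhdsWithin_iff.2 ⟨tendsto_const_nhds.div_atTop tendsto_id, ?_⟩
    filter_upwards [eventually_gt_atTop 0] with s hs using div_pos hv hs
  have h3 := h1.comp_tendsto h2
  simpa only [Function.comp_def, measureReal_restrict_Ioi_Iic, one_div_div,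
    mul_div_assoc, div_eq_mul_inv _ v] using h3

theorem LeftEdgeRegular.tendsto_measureReal_Iic_div (hreg : LeftEdgeRegular μ α L)
    (hedge : leftEdge μ = 0) {v : ℝ} (hv : 0 < v) :
    Tendsto (fun s => (μ.restrict (Ioi 0)).real (Iic (v / s)) /
      (μ.restrict (Ioi 0)).real (Iic (1 / s))) atTop (𝓝 (v ^ α)) := by
  have h1 := (hreg.isEquivalent hedge hv).div (hreg.isEquivalent hedge one_pos)
  refine (h1.tendsto_nhds_iff).2 ?_
  have h2 := (hreg.1 v⁻¹ (inv_pos.2 hv)).const_mul (v ^ α)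
  rw [mul_one] at h2
  refine h2.congr' ?_
  filter_upwards [eventually_gt_atTop 0, hreg.1.eventually_ne_zero] with s hs hL
  have hs' : s ^ α ≠ 0 := (Real.rpow_pos_of_pos hs _).ne'
  simp only [Pi.div_apply, inv_one, mul_one]
  rw [Real.div_rpow hv.le hs.le, Real.div_rpow zero_le_one hs.le,
    Real.one_rpow]
  field_simp

variable [IsFiniteMeasure μ]

/-- The convention `0 ^ 0 = 1` makes the atom at `0` contribute for `k = 0` only. -/
theorem h_eq_laplaceMoment (hM : μ (Icc 0 M)ᶜ = 0) (k : ℕ) (t : ℝ) :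
    h μ γ k t = μ.real {0} * 0 ^ k + laplaceMoment (μ.restrict (Ioi 0)) k (2 * γ * t) := by
  have hI := integrable_pow_mul_exp (ae_restrict_Ioi_mem_Ioc hM) k (2 * γ * t)
  have e : (fun x : ℝ => x ^ k * Real.exp (-2 * γ * t * x)) =
      fun x => x ^ k * Real.exp (-(2 * γ * t) * x) := by
    funext x; ring_nf
  have hIci : Ici (0 : ℝ) = {0} ∪ Ioi 0 := by
    rw [singleton_union, Ioi_insert]
  unfold h laplaceMoment
  rw [e, hIci, setIntegral_union (by simp) measurableSet_Ioi integrableOn_singleton hI,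
    integral_singleton]
  simp

theorem firstMoment_eq_laplaceMoment (hM : μ (Icc 0 M)ᶜ = 0) :
    firstMoment μ = laplaceMoment (μ.restrict (Ioi 0)) 1 0 := by
  have := h_eq_laplaceMoment (γ := 0) hM 1 0
  simpa [h, firstMoment] using this

/-- The mass near `0` is equivalent to an eventually nonzero function, hence is itself nonzero at
arbitrarily small scales; monotonicity does the rest. -/
theorem LeftEdgeRegular.measureReal_Iic_pos (hreg : LeftEdgeRegular μ α L)
    (hedge : leftEdge μ = 0) {y : ℝ} (hy : 0 < y) :
    0 < (μ.restrict (Ioi 0)).real (Iic y) := by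
  have h1 := hreg.isEquivalent hedge one_pos
  simp only [inv_one, mul_one] at h1
  obtain ⟨φ, hφ, hEq⟩ := h1.exists_eq_mul
  obtain ⟨s, ⟨hs1, hs2⟩, ⟨hs3, hs4⟩, hs5⟩ := ((hEq.and (hφ.eventually_ne one_ne_zero)).and
    ((hreg.1.eventually_ne_zero.and (eventually_gt_atTop 0)).and
      (eventually_ge_atTop (1 / y)))).exists
  have hne : (μ.restrict (Ioi 0)).real (Iic (1 / s)) ≠ 0 := by
    refine (hs1.trans_ne ?_ :)
    exact mul_ne_zero hs2 (mul_ne_zero (Real.rpow_pos_of_pos (by positivity) _).ne' hs3)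
  have hle : 1 / s ≤ y := by
    rw [div_le_iff₀ hs4]
    have := (div_le_iff₀ hy).1 hs5
    linarith
  exact (measureReal_nonneg.lt_of_ne hne.symm).trans_le
    (measureReal_mono (Iic_subset_Iic.2 hle))

theorem LeftEdgeRegular.laplaceMoment_isEquivalent (hM : μ (Icc 0 M)ᶜ = 0) (hα : 0 < α)
    (hreg : LeftEdgeRegular μ α L) (hedge : leftEdge μ = 0) {c : ℝ} (hc : 0 < c) (k : ℕ) :
    (fun t => laplaceMoment (μ.restrict (Ioi 0)) k (c * t)) ~[atTop]
      fun t => α * Real.Gamma (α + k) * (c ^ (-(k : ℝ) - α) * (t ^ (-(k : ℝ) - α) * L t)) := by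
  have hν := ae_restrict_Ioi_mem_Ioc hM
  have hpos := fun y hy => hreg.measureReal_Iic_pos hedge (y := y) hy
  have hΓ : α * Real.Gamma (α + k) ≠ 0 :=
    (mul_pos hα (Real.Gamma_pos_of_pos (by positivity))).ne'
  have hct : Tendsto (fun t => c * t) atTop atTop := tendsto_id.const_mul_atTop hc
  have h1 := (tendsto_laplaceMoment_mul_pow_div hν hα hpos
    (fun v hv => hreg.tendsto_measureReal_Iic_div hedge hv) k).comp hct
  have h2 := (isEquivalent_const_iff_tendsto hΓ).2 h1
  have h3 := (hreg.isEquivalent hedge one_pos).comp_tendsto hct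
  have h4 : (fun t => L (t * c)) ~[atTop] L := by
    refine (isEquivalent_iff_tendsto_one hreg.1.eventually_ne_zero).2 (hreg.1 c hc)
  have h6 : (fun t => ((c * t) ^ k)⁻¹) ~[atTop] fun t => ((c * t) ^ k)⁻¹ := IsEquivalent.refl
  have h7 : (fun t => (1 / (c * t)) ^ α * L (c * t)) ~[atTop]
      fun t => (1 / (c * t)) ^ α * L t := by
    have : (fun t => L (c * t)) ~[atTop] L := by simpa only [mul_comm] using h4
    exact (IsEquivalent.refl (u := fun t : ℝ => (1 / (c * t)) ^ α)).mul this
  simp only [Function.comp_def, inv_one, mul_one] at h3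
  have h8 := (h2.mul (h3.trans h7)).mul h6
  refine (h8.congr_left ?_).congr_right ?_
  · filter_upwards [eventually_gt_atTop 0] with t ht
    have hct0 : 0 < c * t := mul_pos hc ht
    have := (hpos (1 / (c * t)) (by positivity)).ne'
    have h9 : (c * t) ^ k ≠ 0 := by positivity
    simp only [Pi.mul_apply, Function.comp_apply]
    rw [div_mul_cancel₀ _ this, mul_assoc, mul_inv_cancel₀ h9, mul_one]
  · filter_upwards [eventually_gt_atTop 0] with t ht
    have hct0 : 0 < c * t := mul_pos hc ht
    simp only [Pi.mul_apply, Function.const_apply]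
    have e1 : (1 / (c * t)) ^ α = (c * t) ^ (-α) := by
      rw [one_div, Real.inv_rpow hct0.le, Real.rpow_neg hct0.le]
    have e2 : ((c * t) ^ k)⁻¹ = (c * t) ^ (-(k : ℝ)) := by
      rw [Real.rpow_neg hct0.le, Real.rpow_natCast]
    have e3 : c ^ (-(k : ℝ) - α) * t ^ (-(k : ℝ) - α) =
        (c * t) ^ (-(k : ℝ)) * (c * t) ^ (-α) := by
      rw [← Real.mul_rpow hc.le ht.le, sub_eq_add_neg, Real.rpow_add hct0]
    rw [e1, e2]
    linear_combination (-(α * Real.Gamma (α + k) * L t)) * e3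

end Problem

end SGDVolterra

/-! ### Assembly of the theorem. -/

open SGDVolterra in
theorem mainTheorem7 (μ : Measure ℝ) [IsFiniteMeasure μ]
    (hμ : ∃ M : ℝ, μ (Icc 0 M)ᶜ = 0)
    (γ r R R' α : ℝ) (L : ℝ → ℝ)
    (hγ : 0 < γ) (hr : 0 < r) (hR : 0 ≤ R) (hR' : 0 ≤ R') (hRR' : 0 < R + R')
    (hγ₀ : γ < SGDVolterra.gammaZero μ r)
    (hedge : SGDVolterra.leftEdge μ = 0)
    (hα : 0 < α) (hreg : SGDVolterra.LeftEdgeRegular μ α L) :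
    ∃ ψ : ℝ → ℝ,
      SGDVolterra.IsVolterraSolution μ γ r R R' ψ ∧
      (∀ φ : ℝ → ℝ, SGDVolterra.IsVolterraSolution μ γ r R R' φ → EqOn φ ψ (Ici 0)) ∧
      Tendsto ψ atTop (𝓝 (SGDVolterra.psiInfty μ γ r R')) ∧
      (0 < R' →
        (fun t : ℝ => ψ t - SGDVolterra.psiInfty μ γ r R') ~[atTop]
          (fun t : ℝ => 1 / (1 - SGDVolterra.theta μ γ r) *
            ((2 * γ) ^ (-α) * (R' * r / 2 * (t ^ (-α) * L t * Real.Gamma (1 + α)))))) ∧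
      (R' = 0 →
        (fun t : ℝ => ψ t - SGDVolterra.psiInfty μ γ r R') ~[atTop]
          (fun t : ℝ => 1 / (1 - SGDVolterra.theta μ γ r) *
            ((2 * γ) ^ (-1 - α) * (α / (1 + α)) *
              (R / 2 * (t ^ (-1 - α) * L t * Real.Gamma (2 + α)))))) := by
  obtain ⟨M, hM⟩ := hμ
  set ν := μ.restrict (Ioi 0) with hνdef
  have hν : ∀ᵐ x ∂ν, x ∈ Ioc 0 M := ae_restrict_Ioi_mem_Ioc hM
  have hpos : ∀ y, 0 < y → 0 < ν.real (Iic y) := fun y hy => hreg.measureReal_Iic_pos hedge hy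
  have hrv : ∀ v, 0 < v → Tendsto (fun s => ν.real (Iic (v / s)) / ν.real (Iic (1 / s))) atTop
      (𝓝 (v ^ α)) := fun v hv => hreg.tendsto_measureReal_Iic_div hedge hv
  have hfirst : firstMoment μ = laplaceMoment ν 1 0 := firstMoment_eq_laplaceMoment hM
  have hhk : ∀ k t, h μ γ k t = μ.real {0} * 0 ^ k + laplaceMoment ν k (2 * γ * t) :=
    h_eq_laplaceMoment hM
  have hν0 : ν ≠ 0 := by
    intro h0
    have := hpos 1 one_pos
    rw [h0] at this
    simp at this
  have hc : 0 < 2 * γ := by positivity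
  have hκ : 0 ≤ γ ^ 2 * r := by positivity
  have hm1 : 0 < firstMoment μ := by
    rw [hfirst]
    exact laplaceMoment_pos hν hν0 1 0
  have hθ : theta μ γ r < 1 := by
    have h1 : 0 < r / 2 * firstMoment μ := by positivity
    have h2 : γ * (r / 2 * firstMoment μ) < 1 := by
      rw [gammaZero, lt_inv_comm₀ hγ h1] at hγ₀
      rwa [← lt_div_iff₀' hγ, one_div]
    rw [theta]
    linarith
  have hθeq : γ ^ 2 * r * ((2 * γ)⁻¹ * laplaceMoment ν 1 0) = theta μ γ r := by
    rw [theta, hfirst]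
    field_simp
  have hh : ∀ (k : ℕ) t, h μ γ (k + 1) t = laplaceMoment ν (k + 1) (2 * γ * t) := fun k t => by
    rw [hhk]; simp
  have hh0 : ∀ t, h μ γ 0 t = μ.real {0} + laplaceMoment ν 0 (2 * γ * t) := fun t => by
    rw [hhk]; simp
  have hHc : ∀ k, Continuous fun t => laplaceMoment ν k (2 * γ * t) := fun k =>
    (continuous_laplaceMoment hν k).comp (continuous_const.mul continuous_id)
  have hK : Continuous fun t => γ ^ 2 * r * laplaceMoment ν 2 (2 * γ * t) :=
    continuous_const.mul (hHc 2)
  have hK0 : ∀ t, 0 ≤ γ ^ 2 * r * laplaceMoment ν 2 (2 * γ * t) := fun t =>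
    mul_nonneg hκ (laplaceMoment_nonneg hν _ _)
  have hKint : ∀ t, ∫ s in (0 : ℝ)..t, γ ^ 2 * r * laplaceMoment ν 2 (2 * γ * s) =
      theta μ γ r - γ * r / 2 * laplaceMoment ν 1 (2 * γ * t) := fun t => by
    rw [intervalIntegral.integral_const_mul, integral_laplaceMoment_comp_mul hν 1 hc, ← hθeq]
    field_simp
  have hKθ : ∀ t, 0 ≤ t →
      ∫ s in (0 : ℝ)..t, γ ^ 2 * r * laplaceMoment ν 2 (2 * γ * s) ≤ theta μ γ r := fun t _ => by
    rw [hKint]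
    have := laplaceMoment_nonneg hν 1 (2 * γ * t)
    have : 0 ≤ γ * r / 2 * laplaceMoment ν 1 (2 * γ * t) := by positivity
    linarith
  have hconv : ∀ (f : ℝ → ℝ) t, γ ^ 2 * r * ∫ s in (0 : ℝ)..t, h μ γ 2 (t - s) * f s =
      ∫ s in (0 : ℝ)..t, γ ^ 2 * r * laplaceMoment ν 2 (2 * γ * (t - s)) * f s := fun f t => by
    rw [← intervalIntegral.integral_const_mul]
    exact intervalIntegral.integral_congr fun s _ => by simp only [hh, mul_assoc]
  have hz : ∀ t, forcing μ γ r R R' t = R / 2 * laplaceMoment ν 1 (2 * γ * t) +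
      R' / 2 * (r * (μ.real {0} + laplaceMoment ν 0 (2 * γ * t)) + (1 - r)) := fun t => by
    rw [forcing, hh0, hh]
  have hH1 := hHc 1
  have hH0 := hHc 0
  have hzc : Continuous (forcing μ γ r R R') := by
    rw [funext hz]
    fun_prop
  have hlim : ∀ k, Tendsto (fun t => laplaceMoment ν k (2 * γ * t)) atTop (𝓝 0) := fun k =>
    (tendsto_laplaceMoment_atTop hν k).comp (tendsto_id.const_mul_atTop hc)
  obtain ⟨C, hC⟩ : ∃ C, ∀ t, 0 ≤ t → |forcing μ γ r R R' t| ≤ C := by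
    refine ⟨R / 2 * laplaceMoment ν 1 0 + R' / 2 * (r * laplaceMoment ν 0 0) +
      |R' / 2 * (r * μ.real {0} + (1 - r))|, fun t ht => ?_⟩
    have b1 : laplaceMoment ν 1 (2 * γ * t) ≤ laplaceMoment ν 1 0 :=
      antitone_laplaceMoment hν 1 (by positivity)
    have b0 : laplaceMoment ν 0 (2 * γ * t) ≤ laplaceMoment ν 0 0 :=
      antitone_laplaceMoment hν 0 (by positivity)
    have p1 := laplaceMoment_nonneg hν 1 (2 * γ * t)
    have p0 := laplaceMoment_nonneg hν 0 (2 * γ * t)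
    have e : forcing μ γ r R R' t = (R / 2 * laplaceMoment ν 1 (2 * γ * t) +
        R' / 2 * (r * laplaceMoment ν 0 (2 * γ * t))) +
          R' / 2 * (r * μ.real {0} + (1 - r)) := by rw [hz]; ring
    rw [e]
    refine (abs_add_le _ _).trans (add_le_add ?_ le_rfl)
    rw [abs_of_nonneg (by positivity)]
    gcongr
  obtain ⟨ψ, hψc, hψ⟩ := exists_continuous_volterra_solution hK hK0 hθ hKθ hzc hC
  have hsol : IsVolterraSolution μ γ r R R' ψ :=
    ⟨hψc.locallyIntegrable.locallyIntegrableOn _, fun t ht => by rw [hconv]; exact hψ t ht⟩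
  set P := psiInfty μ γ r R' with hP
  have hPeq : P * (1 - theta μ γ r) = R' / 2 * (r * μ.real {0} + (1 - r)) := by
    have : 1 - theta μ γ r ≠ 0 := by linarith
    rw [hP, psiInfty]
    field_simp
  -- This is `z(t) - P (1 - ∫_0^t K)`: the constants cancel by `hPeq`, and the missing kernel mass
  -- `(γ r/2) H_1(2γt)` contributes the term with `P`.
  set w : ℝ → ℝ := fun t => (R / 2 - P * (γ * r / 2)) * laplaceMoment ν 1 (2 * γ * t) +
    R' * r / 2 * laplaceMoment ν 0 (2 * γ * t) with hw
  have hu : ∀ t, 0 ≤ t → ψ t - P = w t +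
      ∫ s in (0 : ℝ)..t, γ ^ 2 * r * laplaceMoment ν 2 (2 * γ * (t - s)) * (ψ s - P) := by
    intro t ht
    have h2 := hHc 2
    have hK' : Continuous fun s => γ ^ 2 * r * laplaceMoment ν 2 (2 * γ * (t - s)) :=
      hK.comp (continuous_const.sub continuous_id)
    have e1 : ∫ s in (0 : ℝ)..t, γ ^ 2 * r * laplaceMoment ν 2 (2 * γ * (t - s)) * (ψ s - P) =
        (∫ s in (0 : ℝ)..t, γ ^ 2 * r * laplaceMoment ν 2 (2 * γ * (t - s)) * ψ s) -
          (theta μ γ r - γ * r / 2 * laplaceMoment ν 1 (2 * γ * t)) * P := by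
      rw [← hKint, ← intervalIntegral.integral_mul_const,
        ← integral_convolution_comm (fun t => γ ^ 2 * r * laplaceMoment ν 2 (2 * γ * t))
          (fun _ => P) t, ← intervalIntegral.integral_sub
          (Continuous.intervalIntegrable (by fun_prop) _ _)
          (Continuous.intervalIntegrable (by fun_prop) _ _)]
      simp only [mul_sub]
    rw [e1, hψ t ht, hz, hw]
    linear_combination -hPeq
  have hdouble := fun k => exists_laplaceMoment_half_le hν hα hpos hrv k
  have hC2 : ∀ k, k ≤ 1 →
      ∃ C, 0 < C ∧ ∀ᶠ s in atTop, s * laplaceMoment ν 2 s ≤ C * laplaceMoment ν k s := by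
    intro k hk
    obtain ⟨C₁, hC₁0, hC₁⟩ := exists_mul_laplaceMoment_succ_le hν (hdouble 1)
    interval_cases k
    · obtain ⟨C₀, hC₀0, hC₀⟩ := exists_mul_laplaceMoment_succ_le hν (hdouble 0)
      -- For `s ≥ 1`: `s H_2 ≤ C₁ H_1 ≤ C₁ s H_1 ≤ C₁ C₀ H_0`.
      refine ⟨C₁ * C₀, by positivity, ?_⟩
      filter_upwards [hC₁, hC₀, eventually_ge_atTop 1] with s h1 h0 hs
      have p1 := laplaceMoment_nonneg hν 1 s
      have : laplaceMoment ν 1 s ≤ C₀ * laplaceMoment ν 0 s := by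
        refine le_trans ?_ h0
        simpa using le_mul_of_one_le_left p1 hs
      rw [mul_assoc]
      exact h1.trans (mul_le_mul_of_nonneg_left this hC₁0.le)
    · exact ⟨C₁, hC₁0, hC₁⟩
  have hratio : ∀ k, k ≤ 1 → ∀ a, Tendsto (fun t => w t / laplaceMoment ν k (2 * γ * t)) atTop
      (𝓝 a) → Tendsto (fun t => (ψ t - P) / laplaceMoment ν k (2 * γ * t)) atTop
        (𝓝 (a / (1 - theta μ γ r))) := by
    intro k hk a ha
    rw [← hθeq]
    exact laplaceMoment_volterra_tendsto_div hν hν0 hκ hc (by rwa [hθeq]) (hdouble k) (hC2 k hk)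
      (hψc.sub continuous_const) hu ha
  have hne : ∀ k t, laplaceMoment ν k (2 * γ * t) ≠ 0 := fun k t =>
    (laplaceMoment_pos hν hν0 k _).ne'
  -- Since `H_1 = o(H_0)`, only the `H_0` term of `w` survives. This covers `R' = 0` too, with limit
  -- `0`, so the convergence of `ψ` needs no case distinction.
  have hcase0 : Tendsto (fun t => (ψ t - P) / laplaceMoment ν 0 (2 * γ * t)) atTop
      (𝓝 (R' * r / 2 / (1 - theta μ γ r))) := by
    refine hratio 0 zero_le_one _ ?_
    have h1 := (tendsto_laplaceMoment_succ_div hν hν0 (hdouble 0)).comp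
      (tendsto_id.const_mul_atTop hc)
    have h2 := (h1.const_mul (R / 2 - P * (γ * r / 2))).add_const (R' * r / 2)
    rw [mul_zero, zero_add (R' * r / 2)] at h2
    refine h2.congr fun t => ?_
    have := hne 0 t
    simp only [hw, Function.comp_apply, id_eq, zero_add]
    field_simp
  have hθ1 : 1 - theta μ γ r ≠ 0 := by linarith
  refine ⟨ψ, hsol, fun φ hφ t ht => ?_, ?_, fun hR'pos => ?_, fun hR'0 => ?_⟩
  · have hloc : LocallyIntegrableOn (fun t => φ t - ψ t) (Ici 0) volume :=
      hφ.locallyIntegrable.sub hsol.locallyIntegrable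
    refine sub_eq_zero.1 (volterra_homogeneous_eq_zero hK hK0 hθ hKθ hloc (fun t ht => ?_) ht)
    have hi : ∀ f : ℝ → ℝ, LocallyIntegrableOn f (Ici 0) volume → IntervalIntegrable
        (fun s => γ ^ 2 * r * laplaceMoment ν 2 (2 * γ * (t - s)) * f s) volume 0 t := fun f hf => by
      refine IntervalIntegrable.continuousOn_mul ?_
        (hK.comp (continuous_const.sub continuous_id)).continuousOn
      rw [intervalIntegrable_iff_integrableOn_Icc_of_le ht]
      exact hf.integrableOn_compact_subset Icc_subset_Ici_self isCompact_Icc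
    simp only [mul_sub]
    rw [hφ.equation t ht, hsol.equation t ht, hconv, hconv, add_sub_add_left_eq_sub,
      ← intervalIntegral.integral_sub (hi φ hφ.locallyIntegrable) (hi ψ hsol.locallyIntegrable)]
    simp only [mul_sub]
  · have h1 := (hcase0.mul (hlim 0)).add_const P
    rw [mul_zero, zero_add] at h1
    refine h1.congr fun t => ?_
    rw [div_mul_cancel₀ _ (hne 0 t)]
    ring
  · have hb : R' * r / 2 / (1 - theta μ γ r) ≠ 0 := div_ne_zero (by positivity) hθ1
    have h1 := isEquivalent_of_tendsto_div hb (hne 0) hcase0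
      (hreg.laplaceMoment_isEquivalent hM hα hedge hc 0)
    refine h1.congr_right (Eventually.of_forall fun t => ?_)
    have hΓ : Real.Gamma (1 + α) = α * Real.Gamma α := by
      rw [add_comm, Real.Gamma_add_one hα.ne']
    simp only [Nat.cast_zero, neg_zero, zero_sub, add_zero]
    rw [hΓ]
    ring
  · have hRpos : 0 < R := by linarith
    have hP0 : P = 0 := by rw [hP, psiInfty, hR'0]; simp
    have hb : R / 2 / (1 - theta μ γ r) ≠ 0 := div_ne_zero (by positivity) hθ1
    -- With `R' = 0` also `P = 0`, so `w` is exactly `(R/2) H_1` and `H_1` becomes the comparison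
    -- function.
    have h1 := hratio 1 le_rfl (R / 2) (by
      refine tendsto_const_nhds.congr fun t => ?_
      have := hne 1 t
      simp only [hw, hP0, hR'0]
      field_simp
      ring)
    have h2 := isEquivalent_of_tendsto_div hb (hne 1) h1
      (hreg.laplaceMoment_isEquivalent hM hα hedge hc 1)
    refine h2.congr_right (Eventually.of_forall fun t => ?_)
    -- This accounts for the factor `α/(1+α)`: the Abelian constant `α Γ(1+α)` equals `α/(1+α) ·
    -- Γ(2+α)`.
    have hΓ : Real.Gamma (2 + α) = (1 + α) * Real.Gamma (1 + α) := by
      rw [show (2 : ℝ) + α = (1 + α) + 1 by ring, Real.Gamma_add_one (by positivity)]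
    have h1α : 1 + α ≠ 0 := by positivity
    simp only [Nat.cast_one]
    rw [hΓ, add_comm α 1]
    field_simp
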